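/- Let $N\ge 1$, $M\ge 2$, $V\ge 1$ be integers and $\rho,\gamma\in(0,1]$, and exclude the case $V=1$, $N\ge2$, $\rho=\gamma=1$ (in which every reservation collides). Consider the following symmetric $N$-user network (Frame Slotted ALOHA with Reservation and Data slots, FSA-RD). Time is divided into slots $t=0,1,2,\dots$, slot $t$ occupying $[t,t+1)$, and frame $k\ge 0$ consists of the $M$ slots $kM,\dots,kM+M-1$: the first is the reservation slot, made up of $V$ mini-slots, and the other $M-1$ are data slots. At the beginning of each slot each user generates a status update with probability $\rho$. User $n$ has an update to transmit in frame $k\ge1$ if it generated at least one in frame $k-1$, and then the update is the most recent one of frame $k-1$; in frame $0$ there is none. A user that has an update to transmit in a frame makes a reservation in that frame with probability $\gamma$, by choosing one of the $V$ mini-slots uniformly. All these random choices are independent, over users, slots and frames. A reservation succeeds if no other user chose the same mini-slot in that frame. The first $M-1$ users with successful reservations, in the order of their mini-slots, transmit their updates, one each, in the data slots $1,2,\dots$ of the frame; an update transmitted in slot $t$ is received by the access point at time $t+1$. Updates that are not received in this frame are discarded. The age of information (AoI) of user $n$ is $\delta_n(t)=t-u_n(t)$, where $u_n(t)$ is the generation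 time of the update of user $n$ most recently received until time $t$ (with an arbitrary initial value before the first reception). Put $p=1-(1-\rho)^M$, and, with $0^0=1$, $$\pi_{n_2,n_3}=\frac{(-1)^{n_3}V!\,(n_2+1)!}{V^{n_2+1}\,n_3!}\sum_{m=n_3}^{\min\{V,n_2+1\}}\frac{(-1)^m(V-m)^{n_2+1-m}}{(m-n_3)!\,(V-m)!\,(n_2+1-m)!},$$ $$p_s=\sum_{n_1=0}^{N-1}\sum_{n_2=0}^{n_1}\sum_{n_3=1}^{\min\{V,n_2+1\}}\binom{N-1}{n_1}(1-p)^{N-1-n_1}p^{n_1}\binom{n_1}{n_2}(1-\gamma)^{n_1-n_2}\gamma^{n_2}\,\frac{\min\{n_3,M-1\}}{n_2+1}\,\pi_{n_2,n_3},$$ $$\varphi_\alpha=\sum_{n_1=0}^{N-1}\sum_{n_2=0}^{n_1}\sum_{n_3=\alpha-1}^{\min\{V,n_2+1\}}\binom{N-1}{n_1}(1-p)^{N-1-n_1}p^{n_1}\binom{n_1}{n_2}(1-\gamma)^{n_1-n_2}\gamma^{n_2}\,\frac{1}{n_2+1}\,\pi_{n_2,n_3}\qquad(2\le\alpha\le M).$$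 Then, for every user $n$: $p_s>0$; for every frame $k\ge1$, conditionally on user $n$ having an update and making a reservation in frame $k$, the probability that an update of user $n$ is received within frame $k$ is $p_s$, and the probability that it is transmitted and received in the $\alpha$-th slot of the frame (the $(\alpha-1)$-th data slot) is $\varphi_\alpha$ for $2\le\alpha\le M$; and the average AoI $\bar\Delta=\lim_{T\to\infty}\frac1T\sum_{t=0}^{T-1}\delta_n(t)$ exists almost surely and equals $$\bar\Delta=\frac{M}{\gamma p_s\left(1-(1-\rho)^M\right)}-\frac{M(1-\rho)^M}{1-(1-\rho)^M}+\frac1\rho-\frac{M+1}{2}+\frac{\sum_{\alpha=2}^{M}\alpha\,\varphi_\alpha}{p_s}.$$ -/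

import Mathlib

namespace FSARD

/-! ### The protocol on a fixed sample path

Slots are numbered `0, 1, 2, …`; slot `t` begins at time `t` and ends at time `t + 1`. Slot `t` is
in frame `t / M`, so frame `k` consists of the slots `k * M, …, k * M + (M - 1)`. The first slot of
a frame is the reservation slot (with `V` mini-slots), the other `M - 1` slots are data slots. -/

/-- The basic random choices of all `N` users, for one outcome. -/
structure Path (N V : ℕ) where
  /-- whether user `n` generates a status update at the beginning of slot `t` -/
  arrival : Fin N → ℕ → Bool
  /-- whether user `n` makes a reservation in frame `k`, should it have an update to transmit -/
  coin : Fin N → ℕ → Bool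
  /-- the mini-slot in which user `n` sends its reservation packet in frame `k`, if it reserves -/
  mini : Fin N → ℕ → Fin V

variable {N V : ℕ}

/-- The slots of frame `k - 1` in which user `n` generates a status update
(none if `k = 0`: the buffers are empty at the start). -/
def freshArrivals (M : ℕ) (P : Path N V) (n : Fin N) (k : ℕ) : Finset ℕ :=
  (Finset.range (k * M)).filter (fun t => t / M + 1 = k ∧ P.arrival n t = true)

/-- `I_n(k) = 1`: user `n` has a status update to transmit in frame `k`. -/
def HasUpdate (M : ℕ) (P : Path N V) (n : Fin N) (k : ℕ) : Prop :=
  (freshArrivals M P n k).Nonempty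

/-- The generation time of the update that user `n` holds for frame `k`: only the most recent
update of frame `k - 1` is kept. (Only used when `HasUpdate M P n k`.) -/
def genTime (M : ℕ) (P : Path N V) (n : Fin N) (k : ℕ) : ℕ :=
  (freshArrivals M P n k).sup id

/-- `I_n(k) = 1` and `J_n(k) = 1`: user `n` has an update and makes a reservation in frame `k`. -/
def Reserves (M : ℕ) (P : Path N V) (n : Fin N) (k : ℕ) : Prop :=
  HasUpdate M P n k ∧ P.coin n k = true

/-- User `n` makes a reservation in frame `k` which does not collide. -/
def ReservationSucceeds (M : ℕ) (P : Path N V) (n : Fin N) (k : ℕ) : Prop :=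
  Reserves M P n k ∧ ∀ m : Fin N, m ≠ n → Reserves M P m k → P.mini m k ≠ P.mini n k

open Classical in
/-- The number of successful reservations of frame `k` in mini-slots before that of user `n`. -/
noncomputable def rank (M : ℕ) (P : Path N V) (n : Fin N) (k : ℕ) : ℕ :=
  (Finset.univ.filter
    (fun m : Fin N => ReservationSucceeds M P m k ∧ P.mini m k < P.mini n k)).card

/-- The access point receives a status update of user `n` in slot `t`. The successful users of a
frame use its data slots `1, …, M - 1` in the order of their reservations. Since `t % M < M`, only
the first `M - 1` of them are served. -/
def Received (M : ℕ) (P : Path N V) (n : Fin N) (t : ℕ) : Prop :=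
  ReservationSucceeds M P n (t / M) ∧ t % M = rank M P n (t / M) + 1

/-- `I_a^n(k) = 1`: the access point receives a status update of user `n` within frame `k`. -/
def ReceivedInFrame (M : ℕ) (P : Path N V) (n : Fin N) (k : ℕ) : Prop :=
  ∃ t : ℕ, t / M = k ∧ Received M P n t

open Classical in
/-- `u_n(t)`: the generation time of the status update of user `n` that was most recently received
until time `t` (a reception in slot `t` is complete at time `t + 1`);
`u₀` is the initial value, for the time before the first reception. -/
noncomputable def latestGen (M : ℕ) (P : Path N V) (n : Fin N) (u₀ : ℤ) : ℕ → ℤ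
  | 0 => u₀
  | t + 1 => if Received M P n t then (genTime M P n (t / M) : ℤ) else latestGen M P n u₀ t

/-- The age of information `δ_n(t) = t - u_n(t)`. -/
noncomputable def aoi (M : ℕ) (P : Path N V) (n : Fin N) (u₀ : ℤ) (t : ℕ) : ℤ :=
  (t : ℤ) - latestGen M P n u₀ t

/-! ### The probabilistic model -/

/-- Labels of the basic random variables. -/
inductive Source (N : ℕ) : Type
  | arrival (n : Fin N) (t : ℕ)
  | coin (n : Fin N) (k : ℕ)
  | mini (n : Fin N) (k : ℕ)

/-- The finite set in which a basic random variable takes its values. -/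
def Source.Value (V : ℕ) : Source N → Type
  | .arrival _ _ => Bool
  | .coin _ _ => Bool
  | .mini _ _ => Fin V

instance (s : Source N) : MeasurableSpace (s.Value V) := ⊤

/-- A random path, as one family of random variables. -/
def family {Ω : Type*} (P : Ω → Path N V) : (s : Source N) → Ω → s.Value V
  | .arrival n t => fun ω => (P ω).arrival n t
  | .coin n k => fun ω => (P ω).coin n k
  | .mini n k => fun ω => (P ω).mini n k

/-- The symmetric network: Bernoulli(`ρ`) arrivals in each slot, reservation probability `γ`,
uniform choice of the mini-slot, everything mutually independent. -/
structure IsNetwork {Ω : Type*} [MeasurableSpace Ω] (μ : MeasureTheory.Measure Ω)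
    (ρ γ : ℝ) (P : Ω → Path N V) : Prop where
  measurable : ∀ s : Source N, Measurable (family P s)
  indep : ProbabilityTheory.iIndepFun (family P) μ
  arrival_law : ∀ (n : Fin N) (t : ℕ), μ.real {ω | (P ω).arrival n t = true} = ρ
  coin_law : ∀ (n : Fin N) (k : ℕ), μ.real {ω | (P ω).coin n k = true} = γ
  mini_law : ∀ (n : Fin N) (k : ℕ) (v : Fin V), μ.real {ω | (P ω).mini n k = v} = 1 / (V : ℝ)

/-! ### The closed forms -/

/-- `p = 1 - (1 - ρ)^M`. -/
noncomputable def pUpdate (M : ℕ) (ρ : ℝ) : ℝ := 1 - (1 - ρ) ^ M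

/-- The closed form of `Pr(N_s = n₃ | N_r = r - 1)`. -/
noncomputable def singlePMF (V r n₃ : ℕ) : ℝ :=
  (-1) ^ n₃ * (V.factorial : ℝ) * (r.factorial : ℝ) / ((V : ℝ) ^ r * (n₃.factorial : ℝ)) *
    ∑ m ∈ Finset.Icc n₃ (min V r),
      (-1) ^ m * ((V - m : ℕ) : ℝ) ^ (r - m) /
        (((m - n₃).factorial : ℝ) * ((V - m).factorial : ℝ) * ((r - m).factorial : ℝ))

/-- The closed form of `Pr(N_g = n₁, N_r = n₂)`. -/
noncomputable def othersPMF (N M : ℕ) (ρ γ : ℝ) (n₁ n₂ : ℕ) : ℝ :=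
  ((N - 1).choose n₁ : ℝ) * (1 - pUpdate M ρ) ^ (N - 1 - n₁) * pUpdate M ρ ^ n₁ *
    ((n₁.choose n₂ : ℝ) * (1 - γ) ^ (n₁ - n₂) * γ ^ n₂)

/-- The closed form of `p_s`. -/
noncomputable def pS (N M V : ℕ) (ρ γ : ℝ) : ℝ :=
  ∑ n₁ ∈ Finset.Icc 0 (N - 1), ∑ n₂ ∈ Finset.Icc 0 n₁, ∑ n₃ ∈ Finset.Icc 1 (min V (n₂ + 1)),
    othersPMF N M ρ γ n₁ n₂ * ((min n₃ (M - 1) : ℕ) / ((n₂ : ℝ) + 1)) * singlePMF V (n₂ + 1) n₃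

/-- The closed form of `φ_α`, for `2 ≤ α ≤ M`. -/
noncomputable def phi (N M V : ℕ) (ρ γ : ℝ) (α : ℕ) : ℝ :=
  ∑ n₁ ∈ Finset.Icc 0 (N - 1), ∑ n₂ ∈ Finset.Icc 0 n₁,
    ∑ n₃ ∈ Finset.Icc (α - 1) (min V (n₂ + 1)),
      othersPMF N M ρ γ n₁ n₂ * (1 / ((n₂ : ℝ) + 1)) * singlePMF V (n₂ + 1) n₃

end FSARD

/-!
Call a user *successful* in a frame if it reserves a mini-slot that nobody else reserves. For a
fixed set of `r` reserving users, the number of `m`-sets of successful users, summed over all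
choices of mini-slots, is elementary; binomial inversion yields the law of the number of successful
users, and the symmetry between the users then the probability that a given one comes `j`-th.
Conditioning on the set of reserving users gives `φ` and `p_s`.

For the average age, observe it at the start of the frames. As the random choices of different
frames are independent, this is a process that grows by `M` in every frame, except that it is reset
in a frame where the user is served, to a value depending on that frame alone. The sum of the ages
over a frame is a function of the age at its start and of the choices of the frame. The age at the
start of a frame is independent of the choices of the frame, so replacing the latter by their means
costs sums of orthogonal variables. These are negligible along the squares by Chebyshev's
inequality, and along all frames because ages are nonnegative. What is left telescopes.
-/

namespace FSARD

open Finset MeasureTheory ProbabilityTheory Filter Topology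

/-! ### Binomial inversion -/

lemma sum_range_alternating_choose {d n : ℕ} (hdn : d < n) :
    ∑ i ∈ range n, (-1 : ℤ) ^ i * d.choose i = if d = 0 then 1 else 0 := by
  rw [← Int.alternating_sum_range_choose]
  refine (sum_subset (range_mono hdn) fun i _ hi => ?_).symm
  rw [Nat.choose_eq_zero_of_lt (by simpa using hi), Nat.cast_zero, mul_zero]

lemma sum_alternating_choose_mul_choose {s x b : ℕ} (hxb : x ≤ b) :
    ∑ m ∈ Icc s b, (-1 : ℤ) ^ m * (x.choose m * m.choose s) = if x = s then (-1) ^ s else 0 := by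
  have hterm (i : ℕ) : (-1 : ℤ) ^ (s + i) * (x.choose (s + i) * (s + i).choose s) =
      (-1) ^ s * x.choose s * ((-1) ^ i * (x - s).choose i) := by
    have := Nat.choose_mul (n := x) (Nat.le_add_right s i)
    rw [Nat.add_sub_cancel_left] at this
    rw [← Nat.cast_mul, this]
    push_cast
    ring
  rw [← Ico_add_one_right_eq_Icc, sum_Ico_eq_sum_range, sum_congr rfl fun i _ => hterm i, ← mul_sum]
  rcases lt_trichotomy x s with hlt | rfl | hgt
  · rw [Nat.choose_eq_zero_of_lt hlt, if_neg hlt.ne, Nat.cast_zero, mul_zero, zero_mul]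
  · rw [sum_range_alternating_choose (by omega)]
    simp
  · rw [sum_range_alternating_choose (by omega), if_neg (by omega), if_neg hgt.ne', mul_zero]

lemma card_filter_eq_alternating_sum {β : Type*} (S : Finset β) {X : β → ℕ} {b : ℕ} (s : ℕ)
    (hX : ∀ x ∈ S, X x ≤ b) :
    (#{x ∈ S | X x = s} : ℤ) =
      (-1) ^ s * ∑ m ∈ Icc s b, (-1) ^ m * ((m.choose s * ∑ x ∈ S, (X x).choose m : ℕ) : ℤ) := by
  push_cast
  simp_rw [mul_sum]
  rw [sum_comm, card_filter, Nat.cast_sum]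
  refine sum_congr rfl fun x hx => ?_
  simp_rw [mul_comm (Nat.cast (Nat.choose _ s) : ℤ)]
  rw [← mul_sum, sum_alternating_choose_mul_choose (hX x hx), mul_ite, mul_zero, ← mul_pow]
  simp

/-! ### Points of a map with a value of their own -/

section Singles

variable {ι α : Type*} [DecidableEq ι] [LinearOrder α] {R : Finset ι} {f : ι → α} {i : ι}

/-- The elements of `R` whose value under `f` is taken only once on `R`: the users with a successful
reservation, if `R` is the set of reserving users and `f` the choice of the mini-slots. -/
def singles (R : Finset ι) (f : ι → α) : Finset ι :=
  {i ∈ R | ∀ j ∈ R, j ≠ i → f j ≠ f i}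

/-- The number of singles of `R` with a value smaller than that of `i`. -/
def singleRank (R : Finset ι) (f : ι → α) (i : ι) : ℕ :=
  #{j ∈ singles R f | f j < f i}

lemma mem_singles : i ∈ singles R f ↔ i ∈ R ∧ ∀ j ∈ R, j ≠ i → f j ≠ f i := by
  simp [singles]

lemma singles_subset (R : Finset ι) (f : ι → α) : singles R f ⊆ R :=
  filter_subset _ _

lemma injOn_singles (R : Finset ι) (f : ι → α) : Set.InjOn f (singles R f) := by
  intro i hi j hj hij
  by_contra hne
  exact (mem_singles.1 hj).2 i (mem_singles.1 hi).1 hne hij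

lemma subset_singles_iff {U : Finset ι} (hU : U ⊆ R) :
    U ⊆ singles R f ↔ Set.InjOn f U ∧ ∀ i ∈ R, i ∉ U → ∀ j ∈ U, f j ≠ f i := by
  refine ⟨fun h => ⟨(injOn_singles R f).mono h, fun i hi hiU j hj => ?_⟩,
    fun ⟨hinj, hdisj⟩ i hi => mem_singles.2 ⟨hU hi, fun j hj hji => ?_⟩⟩
  · exact ((mem_singles.1 (h hj)).2 i hi fun hij => hiU (hij ▸ hj)).symm
  · by_cases hjU : j ∈ U
    · exact hinj.ne hjU hi hji
    · exact (hdisj j hj hjU i hi).symm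

lemma card_singles_le [Fintype α] (R : Finset ι) (f : ι → α) :
    #(singles R f) ≤ min (Fintype.card α) #R :=
  le_min (card_le_card_of_injOn f (fun _ _ => mem_univ _) (injOn_singles R f))
    (card_le_card (singles_subset R f))

lemma singleRank_lt_card_singles (hi : i ∈ singles R f) : singleRank R f i < #(singles R f) :=
  card_lt_card (filter_ssubset.2 ⟨i, hi, lt_irrefl _⟩)

lemma singleRank_lt_singleRank {j : ι} (hi : i ∈ singles R f) (hij : f i < f j) :
    singleRank R f i < singleRank R f j := by
  refine card_lt_card ((ssubset_iff_of_subset fun x hx => ?_).2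
    ⟨i, mem_filter.2 ⟨hi, hij⟩, fun h => lt_irrefl _ (mem_filter.1 h).2⟩)
  rw [mem_filter] at hx ⊢
  exact ⟨hx.1, hx.2.trans hij⟩

lemma injOn_singleRank (R : Finset ι) (f : ι → α) :
    Set.InjOn (singleRank R f) (singles R f) := by
  intro i hi j hj hij
  refine injOn_singles R f hi hj (le_antisymm (le_of_not_gt fun h => ?_) (le_of_not_gt fun h => ?_))
  · exact (singleRank_lt_singleRank hj h).ne' hij
  · exact (singleRank_lt_singleRank hi h).ne hij

lemma image_singleRank_singles (R : Finset ι) (f : ι → α) :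
    (singles R f).image (singleRank R f) = range #(singles R f) := by
  refine eq_of_subset_of_card_le (fun x hx => ?_) ?_
  · obtain ⟨i, hi, rfl⟩ := mem_image.1 hx
    exact mem_range.2 (singleRank_lt_card_singles hi)
  · rw [card_image_of_injOn (injOn_singleRank R f), card_range]

lemma card_filter_singleRank_eq (R : Finset ι) (f : ι → α) (j : ℕ) :
    #{i ∈ singles R f | singleRank R f i = j} = if j < #(singles R f) then 1 else 0 := by
  rw [← card_image_of_injOn ((injOn_singleRank R f).mono (coe_subset.2 (filter_subset _ _))),
    ← filter_image (p := (· = j)), image_singleRank_singles, filter_eq']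
  split_ifs <;> simp_all

lemma mem_singles_comp_perm {e : Equiv.Perm ι} (he : ∀ i, e i ∈ R ↔ i ∈ R) :
    i ∈ singles R (f ∘ e) ↔ e i ∈ singles R f := by
  rw [mem_singles, mem_singles, he,
    ← e.forall_congr_right (q := fun j => j ∈ R → j ≠ e i → f j ≠ f (e i))]
  simp only [he, Function.comp_apply, e.injective.ne_iff]

lemma singleRank_comp_perm {e : Equiv.Perm ι} (he : ∀ i, e i ∈ R ↔ i ∈ R) :
    singleRank R (f ∘ e) i = singleRank R f (e i) :=
  card_equiv e fun j => by simp only [mem_filter, mem_singles_comp_perm he, Function.comp_apply]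

end Singles

section Counting

variable {ι α : Type*} [Fintype ι] [DecidableEq ι] [Fintype α] [LinearOrder α] {R : Finset ι}

lemma card_singleRank_eq_of_mem {i k : ι} (hi : i ∈ R) (hk : k ∈ R) (j : ℕ) :
    #{f : ι → α | k ∈ singles R f ∧ singleRank R f k = j} =
      #{f : ι → α | i ∈ singles R f ∧ singleRank R f i = j} := by
  have hswap : ∀ x, Equiv.swap i k x ∈ R ↔ x ∈ R := fun x => by
    rcases eq_or_ne x i with rfl | hxi
    · simp [hk, hi]
    rcases eq_or_ne x k with rfl | hxk
    · simp [hk, hi]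
    rw [Equiv.swap_apply_of_ne_of_ne hxi hxk]
  refine card_equiv ((Equiv.swap i k).arrowCongr (Equiv.refl α)) fun f => ?_
  have hcomp : (Equiv.swap i k).arrowCongr (Equiv.refl α) f = f ∘ Equiv.swap i k := by
    ext; simp
  simp [hcomp, mem_singles_comp_perm hswap, singleRank_comp_perm hswap]

lemma card_mul_card_singleRank_eq {i : ι} (hi : i ∈ R) (j : ℕ) :
    #R * #{f : ι → α | i ∈ singles R f ∧ singleRank R f i = j} =
      #{f : ι → α | j < #(singles R f)} := by
  calc #R * #{f : ι → α | i ∈ singles R f ∧ singleRank R f i = j}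
      = ∑ k ∈ R, #{f : ι → α | k ∈ singles R f ∧ singleRank R f k = j} := by
        rw [sum_congr rfl fun k hk => card_singleRank_eq_of_mem hi hk j, sum_const, smul_eq_mul]
    _ = ∑ f : ι → α, #{k ∈ R | k ∈ singles R f ∧ singleRank R f k = j} :=
        sum_card_bipartiteAbove_eq_sum_card_bipartiteBelow _
    _ = ∑ f : ι → α, #{k ∈ singles R f | singleRank R f k = j} := by
        simp only [← filter_filter, filter_mem_eq_inter, inter_eq_right.2 (singles_subset _ _)]
    _ = #{f : ι → α | j < #(singles R f)} := by
        rw [card_filter, sum_congr rfl fun f _ => card_filter_singleRank_eq R f j]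

lemma card_extensions_avoiding {U : Finset ι} (hU : U ⊆ R) (g : U ↪ α) :
    #{f : ι → α | (∀ i : U, f i = g i) ∧ ∀ i ∈ R, i ∉ U → ∀ j : U, g j ≠ f i} =
      (Fintype.card α - #U) ^ (#R - #U) * Fintype.card α ^ (Fintype.card ι - #R) := by
  let allowed (i : ι) : Finset α :=
    if h : i ∈ U then {g ⟨i, h⟩} else if i ∈ R then (univ.map g)ᶜ else univ
  have card_allowed (i : ι) : #(allowed i) =
      (if i ∈ R \ U then Fintype.card α - #U else 1) * (if i ∈ Rᶜ then Fintype.card α else 1) := by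
    by_cases hiU : i ∈ U
    · simp [allowed, hiU, hU hiU]
    · by_cases hiR : i ∈ R <;> simp [allowed, hiU, hiR, card_compl]
  have hfilter : ({f : ι → α | (∀ i : U, f i = g i) ∧ ∀ i ∈ R, i ∉ U → ∀ j : U, g j ≠ f i} :
      Finset (ι → α)) = Fintype.piFinset allowed := by
    ext f
    simp only [mem_filter, mem_univ, true_and, Fintype.mem_piFinset, allowed, Subtype.forall,
      ← forall_and]
    refine forall_congr' fun i => ?_
    by_cases hiU : i ∈ U
    · simp [hiU]
    · by_cases hiR : i ∈ R <;> simp [hiU, hiR]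
  rw [hfilter, Fintype.card_piFinset, prod_congr rfl fun i _ => card_allowed i, prod_mul_distrib,
    prod_ite_mem, prod_ite_mem]
  simp [card_sdiff_of_subset hU, card_compl]

lemma card_subset_singles {U : Finset ι} (hU : U ⊆ R) :
    #{f : ι → α | U ⊆ singles R f} = (Fintype.card α).descFactorial #U *
      ((Fintype.card α - #U) ^ (#R - #U) * Fintype.card α ^ (Fintype.card ι - #R)) := by
  have hunion : ({f : ι → α | U ⊆ singles R f} : Finset (ι → α)) =
      (univ : Finset (U ↪ α)).biUnion fun g =>
        {f | (∀ i : U, f i = g i) ∧ ∀ i ∈ R, i ∉ U → ∀ j : U, g j ≠ f i} := by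
    ext f
    simp only [mem_filter, mem_univ, true_and, mem_biUnion, subset_singles_iff hU]
    constructor
    · rintro ⟨hinj, hdisj⟩
      exact ⟨⟨fun i => f i, hinj.injective⟩, fun _ => rfl,
        fun i hi hiU j => hdisj i hi hiU j j.2⟩
    · rintro ⟨g, hfg, hdisj⟩
      refine ⟨fun i hi j hj hij => ?_, fun i hi hiU j hj => hfg ⟨j, hj⟩ ▸ hdisj i hi hiU ⟨j, hj⟩⟩
      rw [hfg ⟨i, hi⟩, hfg ⟨j, hj⟩] at hij
      exact congrArg Subtype.val (g.injective hij)
  rw [hunion, card_biUnion, sum_congr rfl fun g _ => card_extensions_avoiding hU g]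
  · simp [Fintype.card_embedding_eq]
  · intro g _ g' _ hne
    rw [Function.onFun, Finset.disjoint_left]
    intro f hf hf'
    refine hne (DFunLike.ext _ _ fun i => ?_)
    rw [← (mem_filter.1 hf).2.1 i, (mem_filter.1 hf').2.1 i]

lemma sum_choose_card_singles (R : Finset ι) (m : ℕ) :
    ∑ f : ι → α, (#(singles R f)).choose m =
      (#R).choose m * ((Fintype.card α).descFactorial m *
        ((Fintype.card α - m) ^ (#R - m) * Fintype.card α ^ (Fintype.card ι - #R))) := by
  have hchoose (f : ι → α) :
      (#(singles R f)).choose m = #{U ∈ powersetCard m R | U ⊆ singles R f} := by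
    rw [← card_powersetCard]
    congr 1
    ext U
    simp only [mem_powersetCard, mem_filter]
    exact ⟨fun h => ⟨⟨h.1.trans (singles_subset R f), h.2⟩, h.1⟩, fun h => ⟨h.2, h.1.2⟩⟩
  calc ∑ f : ι → α, (#(singles R f)).choose m
      = ∑ U ∈ powersetCard m R, #{f : ι → α | U ⊆ singles R f} := by
        simp only [hchoose]
        exact (sum_card_bipartiteAbove_eq_sum_card_bipartiteBelow _).symm
    _ = _ := by
        rw [← card_powersetCard m R, ← smul_eq_mul, ← sum_const]
        refine sum_congr rfl fun U hU => ?_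
        obtain ⟨hUR, rfl⟩ := mem_powersetCard.1 hU
        exact card_subset_singles hUR

lemma card_card_singles_eq [Nonempty α] (R : Finset ι) (s : ℕ) :
    (#{f : ι → α | #(singles R f) = s} : ℝ) =
      (Fintype.card α : ℝ) ^ Fintype.card ι * singlePMF (Fintype.card α) #R s := by
  have hinversion := congrArg (Int.cast (R := ℝ)) (card_filter_eq_alternating_sum
    (univ : Finset (ι → α)) s fun f _ => card_singles_le R f)
  simp_rw [sum_choose_card_singles] at hinversion
  push_cast at hinversion
  set V := Fintype.card α
  have hV : (V : ℝ) ≠ 0 := by exact_mod_cast Fintype.card_ne_zero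
  rw [hinversion, singlePMF, mul_sum, mul_sum, mul_sum]
  refine sum_congr rfl fun m hm => ?_
  obtain ⟨hsm, hmV, hmR⟩ : s ≤ m ∧ m ≤ V ∧ m ≤ #R := by simpa using hm
  have hdesc : (V.descFactorial m : ℝ) = V.factorial / (V - m).factorial := by
    rw [eq_div_iff (by positivity)]
    exact_mod_cast (mul_comm _ _).trans (Nat.factorial_mul_descFactorial hmV)
  have hpow : (V : ℝ) ^ Fintype.card ι = V ^ #R * V ^ (Fintype.card ι - #R) := by
    rw [← pow_add, Nat.add_sub_cancel' (card_le_univ R)]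
  rw [hdesc, hpow, Nat.cast_choose ℝ hsm, Nat.cast_choose ℝ hmR]
  field_simp

/-- The probability that a given one of `r` reserving users has the `j`-th successful reservation
of the frame, counting from `0`. -/
noncomputable def rankPMF (V r j : ℕ) : ℝ :=
  1 / (r : ℝ) * ∑ s ∈ Icc (j + 1) (min V r), singlePMF V r s

lemma card_singleRank_eq [Nonempty α] {i : ι} (hi : i ∈ R) (j : ℕ) :
    (#{f : ι → α | i ∈ singles R f ∧ singleRank R f i = j} : ℝ) =
      (Fintype.card α : ℝ) ^ Fintype.card ι * rankPMF (Fintype.card α) #R j := by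
  have hR : (#R : ℝ) ≠ 0 := by exact_mod_cast (card_pos.2 ⟨i, hi⟩).ne'
  have htail : #{f : ι → α | j < #(singles R f)} =
      ∑ s ∈ Icc (j + 1) (min (Fintype.card α) #R), #{f : ι → α | #(singles R f) = s} := by
    rw [card_eq_sum_card_fiberwise (f := fun f => #(singles R f))
      (t := Icc (j + 1) (min (Fintype.card α) #R))]
    · refine sum_congr rfl fun s hs => ?_
      rw [filter_filter]
      congr 1
      ext f
      have := (mem_Icc.1 hs).1
      simp only [mem_filter, mem_univ, true_and]
      omega
    · intro f hf
      exact mem_Icc.2 ⟨(mem_filter.1 hf).2, card_singles_le R f⟩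
  have hsymm := congrArg (Nat.cast (R := ℝ)) ((card_mul_card_singleRank_eq hi j).trans htail)
  push_cast [card_card_singles_eq] at hsymm
  rw [← mul_sum] at hsymm
  rw [rankPMF]
  field_simp
  linear_combination hsymm

end Counting

/-! ### The closed forms as binomial averages -/

/-- Weighting by the binomial law of parameter `p` and then by those of parameter `γ` gives the
binomial law of parameter `p * γ`. -/
lemma sum_choose_mul_sum_choose {A : Type*} [CommRing A] (L : ℕ) (p γ : A) (F : ℕ → A) :
    ∑ n₁ ∈ Icc 0 L, ∑ n₂ ∈ Icc 0 n₁, (L.choose n₁ : A) * (1 - p) ^ (L - n₁) * p ^ n₁ *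
        ((n₁.choose n₂ : A) * (1 - γ) ^ (n₁ - n₂) * γ ^ n₂) * F n₂ =
      ∑ r ∈ range (L + 1), (L.choose r : A) * ((p * γ) ^ r * (1 - p * γ) ^ (L - r)) * F r := by
  rw [sum_comm' (t' := range (L + 1)) (s' := fun r => Icc r L)
    (by intro x y; simp only [mem_Icc, mem_range]; omega)]
  refine sum_congr rfl fun r hr => ?_
  obtain ⟨d, rfl⟩ := Nat.exists_eq_add_of_le (mem_range_succ_iff.1 hr)
  rw [← Ico_add_one_right_eq_Icc, sum_Ico_eq_sum_range, show r + d + 1 - r = d + 1 by omega,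
    Nat.add_sub_cancel_left, show 1 - p * γ = p * (1 - γ) + (1 - p) by ring, add_pow, mul_sum,
    mul_sum, sum_mul]
  refine sum_congr rfl fun i _ => ?_
  have hchoose := congrArg (Nat.cast (R := A)) (Nat.choose_mul (n := r + d) (Nat.le_add_right r i))
  simp only [Nat.add_sub_cancel_left, Nat.cast_mul] at hchoose
  simp only [Nat.add_sub_cancel_left, Nat.add_sub_add_left, pow_add, mul_pow]
  linear_combination ((1 - p) ^ (d - i) * p ^ r * p ^ i * (1 - γ) ^ i * γ ^ r * F r) * hchoose

lemma phi_add_two_eq_sum_rankPMF (N M V : ℕ) (ρ γ : ℝ) (j : ℕ) :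
    phi N M V ρ γ (j + 2) = ∑ r ∈ range (N - 1 + 1), ((N - 1).choose r : ℝ) *
      ((pUpdate M ρ * γ) ^ r * (1 - pUpdate M ρ * γ) ^ (N - 1 - r)) * rankPMF V (r + 1) j := by
  rw [← sum_choose_mul_sum_choose, phi]
  refine sum_congr rfl fun n₁ _ => sum_congr rfl fun n₂ _ => ?_
  simp only [rankPMF, mul_sum, Nat.cast_add_one, othersPMF, mul_assoc]
  rfl

lemma pS_eq_sum_phi (N M V : ℕ) (ρ γ : ℝ) :
    pS N M V ρ γ = ∑ α ∈ Icc 2 M, phi N M V ρ γ α := by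
  simp only [phi, pS]
  rw [sum_comm]
  refine sum_congr rfl fun n₁ _ => ?_
  rw [sum_comm]
  refine sum_congr rfl fun n₂ _ => ?_
  rw [sum_comm' (t' := Icc 1 (min V (n₂ + 1))) (s' := fun s => Icc 2 (min (s + 1) M))
    (by intro x y; simp only [mem_Icc]; omega)]
  refine sum_congr rfl fun s hs => ?_
  have hcard : min (s + 1) M + 1 - 2 = min s (M - 1) := by
    have := (mem_Icc.1 hs).1
    omega
  rw [sum_const, Nat.card_Icc, hcard, nsmul_eq_mul]
  ring

lemma sum_Icc_two_eq_sum_range (M : ℕ) (F : ℕ → ℝ) :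
    ∑ α ∈ Icc 2 M, F α = ∑ j ∈ range (M - 1), F (j + 2) := by
  rw [← Ico_add_one_right_eq_Icc, sum_Ico_eq_sum_range]
  exact sum_congr (by congr 1) fun j _ => by rw [add_comm]

lemma pS_eq_sum_range_phi (N M V : ℕ) (ρ γ : ℝ) :
    pS N M V ρ γ = ∑ j ∈ range (M - 1), phi N M V ρ γ (j + 2) := by
  rw [pS_eq_sum_phi, sum_Icc_two_eq_sum_range]

/-! ### Averages over independent users -/

/-- The weights of a Bernoulli variable with parameter `x`. -/
noncomputable def bern (x : ℝ) (b : Bool) : ℝ := if b then x else 1 - x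

section Users

variable {ι Y α : Type*} [Fintype ι] [DecidableEq ι] [Fintype Y] [Fintype α] [LinearOrder α]

lemma sum_powerset_card_of_mem {A : Type*} [AddCommMonoid A] (n : ι) (F : ℕ → A) :
    ∑ R : Finset ι with n ∈ R, F #R =
      ∑ r ∈ range (Fintype.card ι - 1 + 1), (Fintype.card ι - 1).choose r • F (r + 1) := by
  rw [← card_univ, ← card_erase_of_mem (mem_univ n),
    ← sum_powerset_apply_card fun r => F (r + 1)]
  refine sum_bij' (fun R _ => R.erase n) (fun S _ => insert n S) ?_ ?_ ?_ ?_ ?_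
  · exact fun R _ => mem_powerset.2 (erase_subset_erase _ (subset_univ _))
  · simp
  · exact fun R hR => insert_erase (mem_filter.1 hR).2
  · exact fun S hS => erase_insert fun h => by simpa using mem_powerset.1 hS h
  · exact fun R hR => by rw [card_erase_add_one (mem_filter.1 hR).2]

lemma sum_prod_mul_eq_sum_fiberwise (flag : Y → Bool) (mini : Y → α) (w : ι → Y → ℝ)
    (G : Finset ι → (ι → α) → ℝ) :
    ∑ z : ι → Y, (∏ m, w m (z m)) * G {m | flag (z m)} (fun m => mini (z m)) =
      ∑ R, ∑ f, (∏ m, ∑ y with flag y = decide (m ∈ R) ∧ mini y = f m, w m y) * G R f := by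
  rw [← Fintype.sum_prod_type', ← sum_fiberwise univ fun z : ι → Y =>
    (({m | flag (z m)} : Finset ι), fun m => mini (z m))]
  refine sum_congr rfl fun ⟨R, f⟩ _ => ?_
  have hfiber : ({z : ι → Y | (({m | flag (z m)} : Finset ι), fun m => mini (z m)) = (R, f)} :
      Finset (ι → Y)) =
      Fintype.piFinset fun m => {y | flag y = decide (m ∈ R) ∧ mini y = f m} := by
    ext z
    simp only [mem_filter, mem_univ, true_and, Prod.mk.injEq, Fintype.mem_piFinset, forall_and,
      funext_iff, Finset.ext_iff]
    refine and_congr_left' (forall_congr' fun m => ?_)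
    by_cases hm : m ∈ R <;> simp [hm]
  rw [prod_univ_sum, ← hfiber, sum_mul]
  refine sum_congr rfl fun z hz => ?_
  obtain ⟨hR, hf⟩ := Prod.mk.inj (mem_filter.1 hz).2
  rw [hR, hf]

lemma prod_fiber_weight {flag : Y → Bool} {mini : Y → α} {w F : Y → ℝ} {θ c : ℝ}
    (hw : ∀ b v, ∑ y with flag y = b ∧ mini y = v, w y = bern θ b / Fintype.card α)
    (hF : ∀ v, ∑ y with flag y = true ∧ mini y = v, w y * F y = c / Fintype.card α)
    {n : ι} {R : Finset ι} (hn : n ∈ R) (f : ι → α) :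
    ∏ m, ∑ y with flag y = decide (m ∈ R) ∧ mini y = f m, w y * (if m = n then F y else 1) =
      c * (θ ^ (#R - 1) * (1 - θ) ^ (Fintype.card ι - #R)) /
        (Fintype.card α : ℝ) ^ Fintype.card ι := by
  have hfactor (m : ι) : ∑ y with flag y = decide (m ∈ R) ∧ mini y = f m,
      w y * (if m = n then F y else 1) =
      (if m = n then c else 1) * (if m ∈ R.erase n then θ else 1) *
        (if m ∈ Rᶜ then 1 - θ else 1) * (Fintype.card α : ℝ)⁻¹ := by
    rcases eq_or_ne m n with rfl | hmn
    · simp [hn, hF, div_eq_mul_inv]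
    · by_cases hm : m ∈ R <;> simp [hmn, hm, hw, bern, div_eq_mul_inv]
  rw [prod_congr rfl fun m _ => hfactor m, prod_mul_distrib, prod_mul_distrib, prod_mul_distrib,
    prod_ite_mem, prod_ite_mem, prod_ite_eq' univ n]
  simp [card_compl, card_erase_of_mem hn, div_eq_mul_inv, mul_assoc]

/-- Every user independently has a state in `Y` with weights `w`; it reserves if `flag` holds, in
the mini-slot `mini`. -/
lemma sum_prod_mul_singleRank [Nonempty α] {flag : Y → Bool} {mini : Y → α} {w F : Y → ℝ}
    {θ c : ℝ} (hw : ∀ b v, ∑ y with flag y = b ∧ mini y = v, w y = bern θ b / Fintype.card α)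
    (hF : ∀ v, ∑ y with flag y = true ∧ mini y = v, w y * F y = c / Fintype.card α)
    (n : ι) (j : ℕ) :
    ∑ z : ι → Y, (∏ m, w (z m)) *
        (if n ∈ singles {m | flag (z m)} (fun m => mini (z m)) ∧
          singleRank {m | flag (z m)} (fun m => mini (z m)) n = j then F (z n) else 0) =
      c * ∑ r ∈ range (Fintype.card ι - 1 + 1), ((Fintype.card ι - 1).choose r : ℝ) *
        (θ ^ r * (1 - θ) ^ (Fintype.card ι - 1 - r)) * rankPMF (Fintype.card α) (r + 1) j := by
  let K (r : ℕ) : ℝ :=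
    c * (θ ^ (r - 1) * (1 - θ) ^ (Fintype.card ι - r)) * rankPMF (Fintype.card α) r j
  calc _ = ∑ z : ι → Y, (∏ m, w (z m) * (if m = n then F (z m) else 1)) *
        (if n ∈ singles {m | flag (z m)} (fun m => mini (z m)) ∧
          singleRank {m | flag (z m)} (fun m => mini (z m)) n = j then 1 else 0) := by
        refine sum_congr rfl fun z _ => ?_
        rw [prod_mul_distrib, prod_ite_eq' univ n, if_pos (mem_univ n), mul_assoc, mul_boole]
    _ = ∑ R : Finset ι, ∑ f : ι → α,
        (∏ m, ∑ y with flag y = decide (m ∈ R) ∧ mini y = f m,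
          w y * (if m = n then F y else 1)) *
        (if n ∈ singles R f ∧ singleRank R f n = j then 1 else 0) :=
        sum_prod_mul_eq_sum_fiberwise flag mini (fun m y => w y * (if m = n then F y else 1))
          fun R f => if n ∈ singles R f ∧ singleRank R f n = j then 1 else 0
    _ = ∑ R : Finset ι, if n ∈ R then K #R else 0 := by
        refine sum_congr rfl fun R _ => ?_
        simp only [mul_boole]
        rw [← sum_filter]
        split_ifs with hn
        · rw [sum_congr rfl fun f _ => prod_fiber_weight hw hF hn f, sum_const, nsmul_eq_mul,
            card_singleRank_eq hn]
          field_simp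
          simp only [K]
          ring
        · rw [filter_false_of_mem fun f _ h => hn (singles_subset R f h.1), sum_empty]
    _ = _ := by
        rw [← sum_filter, sum_powerset_card_of_mem, mul_sum]
        refine sum_congr rfl fun r _ => ?_
        rw [nsmul_eq_mul, Nat.sub_right_comm, ← Nat.sub_add_eq]
        simp only [K, Nat.add_sub_cancel]
        ring

end Users

/-! ### The choices that determine a frame -/

lemma mul_add_div_of_lt {M k s : ℕ} (hs : s < M) : (k * M + s) / M = k := by
  rw [mul_comm, Nat.mul_add_div (Nat.zero_lt_of_lt hs), Nat.div_eq_of_lt hs, add_zero]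

/-- The choices of one user which matter in a frame: its arrivals in the frame before, its coin
and its mini-slot. -/
abbrev UserFrame (M V : ℕ) : Type := (Fin M → Bool) × Bool × Fin V

variable {N M V : ℕ}

/-- Whether a user with these choices makes a reservation. -/
def UserFrame.flag (y : UserFrame M V) : Bool := decide (∃ t, y.1 t = true) && y.2.1

/-- The choices of all users which matter in frame `k + 1`. (Nothing is transmitted in frame `0`,
so the frames are numbered from the second one.) -/
def frameOf (M : ℕ) (P : Path N V) (k : ℕ) : Fin N → UserFrame M V :=
  fun m => (fun t => P.arrival m (k * M + t), P.coin m (k + 1), P.mini m (k + 1))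

/-- The users making a reservation in a frame with choices `z`. -/
def reservers (z : Fin N → UserFrame M V) : Finset (Fin N) :=
  {m | (z m).flag}

/-- User `n` is successful, after `j` other successful users. -/
def Served (z : Fin N → UserFrame M V) (n : Fin N) (j : ℕ) : Prop :=
  n ∈ singles (reservers z) (fun m => (z m).2.2) ∧
    singleRank (reservers z) (fun m => (z m).2.2) n = j

instance (z : Fin N → UserFrame M V) (n : Fin N) (j : ℕ) : Decidable (Served z n j) := by
  unfold Served; infer_instance

/-- User `n` is successful, after fewer than `m` other successful users. -/
def ServedBefore (z : Fin N → UserFrame M V) (n : Fin N) (m : ℕ) : Prop := ∃ j < m, Served z n j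

instance (z : Fin N → UserFrame M V) (n : Fin N) (m : ℕ) : Decidable (ServedBefore z n m) := by
  unfold ServedBefore; infer_instance

/-- The position in its frame of the last arrival (`0` if there is none). -/
def lastArrival (a : Fin M → Bool) : ℕ := ({t | a t} : Finset (Fin M)).sup Fin.val

lemma Served.flag {z : Fin N → UserFrame M V} {n : Fin N} {j : ℕ} (h : Served z n j) :
    (z n).flag = true := by
  simpa [reservers] using singles_subset _ _ h.1

lemma ServedBefore.flag {z : Fin N → UserFrame M V} {n : Fin N} {m : ℕ}
    (h : ServedBefore z n m) : (z n).flag = true :=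
  h.choose_spec.2.flag

lemma Served.exists_arrival {z : Fin N → UserFrame M V} {n : Fin N} {j : ℕ} (h : Served z n j) :
    ∃ t, (z n).1 t = true := by
  have hflag := h.flag
  rw [UserFrame.flag, Bool.and_eq_true, decide_eq_true_iff] at hflag
  exact hflag.1

lemma Served.unique {z : Fin N → UserFrame M V} {n : Fin N} {i j : ℕ} (hi : Served z n i)
    (hj : Served z n j) : i = j :=
  hi.2.symm.trans hj.2

lemma mem_freshArrivals_succ (hM : 0 < M) (P : Path N V) (n : Fin N) (k t : ℕ) :
    t ∈ freshArrivals M P n (k + 1) ↔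
      ∃ s : Fin M, t = k * M + s ∧ P.arrival n (k * M + s) = true := by
  simp only [freshArrivals, mem_filter, mem_range, add_left_inj]
  constructor
  · rintro ⟨-, rfl, harr⟩
    have ht : t = t / M * M + t % M := (Nat.div_add_mod' t M).symm
    exact ⟨⟨t % M, Nat.mod_lt _ hM⟩, ht, by rw [← ht]; exact harr⟩
  · rintro ⟨s, rfl, harr⟩
    exact ⟨by rw [add_mul, one_mul]; omega, mul_add_div_of_lt s.2, harr⟩

lemma not_hasUpdate_zero (P : Path N V) (n : Fin N) : ¬ HasUpdate M P n 0 := by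
  simp [HasUpdate, freshArrivals]

lemma hasUpdate_succ_iff (hM : 0 < M) (P : Path N V) (n : Fin N) (k : ℕ) :
    HasUpdate M P n (k + 1) ↔ ∃ t, (frameOf M P k n).1 t = true := by
  constructor
  · rintro ⟨t, ht⟩
    obtain ⟨s, -, hs⟩ := (mem_freshArrivals_succ hM P n k t).1 ht
    exact ⟨s, hs⟩
  · rintro ⟨s, hs⟩
    exact ⟨_, (mem_freshArrivals_succ hM P n k _).2 ⟨s, rfl, hs⟩⟩

lemma reserves_succ_iff (hM : 0 < M) (P : Path N V) (n : Fin N) (k : ℕ) :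
    Reserves M P n (k + 1) ↔ (frameOf M P k n).flag = true := by
  rw [Reserves, hasUpdate_succ_iff hM, UserFrame.flag, Bool.and_eq_true, decide_eq_true_iff]
  rfl

lemma reservationSucceeds_succ_iff (hM : 0 < M) (P : Path N V) (n : Fin N) (k : ℕ) :
    ReservationSucceeds M P n (k + 1) ↔
      n ∈ singles (reservers (frameOf M P k)) (fun m => (frameOf M P k m).2.2) := by
  simp only [mem_singles, reservers, mem_filter, mem_univ, true_and, ← reserves_succ_iff hM]
  exact and_congr_right fun _ => forall_congr' fun m => forall_comm

lemma rank_succ (hM : 0 < M) (P : Path N V) (n : Fin N) (k : ℕ) :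
    rank M P n (k + 1) =
      singleRank (reservers (frameOf M P k)) (fun m => (frameOf M P k m).2.2) n := by
  classical
  unfold rank singleRank
  congr 1
  ext m
  simp only [mem_filter, mem_univ, true_and, reservationSucceeds_succ_iff hM]
  rfl

lemma received_iff_served (P : Path N V) (n : Fin N) (k : ℕ) {j : ℕ} (hj : j + 1 < M) :
    Received M P n ((k + 1) * M + (j + 1)) ↔ Served (frameOf M P k) n j := by
  have hM : 0 < M := by omega
  rw [Received, mul_add_div_of_lt hj, Nat.mul_add_mod_of_lt hj, reservationSucceeds_succ_iff hM,
    rank_succ hM, Served, add_left_inj, eq_comm (a := j)]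

lemma not_received_frame_start (P : Path N V) (n : Fin N) (k : ℕ) : ¬ Received M P n (k * M) := by
  simp [Received]

lemma not_received_of_lt (P : Path N V) (n : Fin N) {t : ℕ} (ht : t < M) :
    ¬ Received M P n t := by
  rintro ⟨⟨⟨hupdate, -⟩, -⟩, -⟩
  rw [Nat.div_eq_of_lt ht] at hupdate
  exact not_hasUpdate_zero P n hupdate

lemma receivedInFrame_succ_iff (P : Path N V) (n : Fin N) (k : ℕ) :
    ReceivedInFrame M P n (k + 1) ↔ ServedBefore (frameOf M P k) n (M - 1) := by
  constructor
  · rintro ⟨t, ht, hrec⟩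
    have hM : 0 < M := Nat.pos_of_ne_zero fun h => by simp [h] at ht
    have hlt := Nat.mod_lt t hM
    have hdiv := Nat.div_add_mod' t M
    rw [ht, hrec.2] at hdiv
    rw [hrec.2] at hlt
    exact ⟨_, by omega, (received_iff_served P n k hlt).1 (by rwa [hdiv])⟩
  · rintro ⟨j, hj, hserved⟩
    have hj' : j + 1 < M := by omega
    exact ⟨_, mul_add_div_of_lt hj', (received_iff_served P n k hj').2 hserved⟩

lemma genTime_succ (hM : 0 < M) (P : Path N V) (n : Fin N) (k : ℕ)
    (h : ∃ t, (frameOf M P k n).1 t = true) :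
    genTime M P n (k + 1) = k * M + lastArrival (frameOf M P k n).1 := by
  obtain ⟨t, ht⟩ := h
  refine le_antisymm (Finset.sup_le fun x hx => ?_) ?_
  · obtain ⟨s, rfl, hs⟩ := (mem_freshArrivals_succ hM P n k x).1 hx
    exact Nat.add_le_add_left (Finset.le_sup (f := Fin.val) (mem_filter.2 ⟨mem_univ s, hs⟩)) _
  · obtain ⟨s, hs, hlast⟩ := exists_mem_eq_sup
      ({t | (frameOf M P k n).1 t} : Finset (Fin M)) ⟨t, by simpa using ht⟩ Fin.val
    rw [lastArrival, hlast]
    exact Finset.le_sup (f := id)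
      ((mem_freshArrivals_succ hM P n k _).2 ⟨s, rfl, (mem_filter.1 hs).2⟩)

/-! ### The law of a frame -/

section Blocks

variable {Ω ι : Type*} {κ : ι → Type*} {𝓧 : (i : ι) → κ i → Type*} [MeasurableSpace Ω]
  {μ : Measure Ω} [∀ i j, MeasurableSpace (𝓧 i j)]

lemma iIndepFun_curry [IsProbabilityMeasure μ] {X : (i : ι) → (j : κ i) → Ω → 𝓧 i j}
    (hX : ∀ i j, Measurable (X i j)) (h : iIndepFun (fun p : (i : ι) × κ i => X p.1 p.2) μ) :
    iIndepFun (fun i ω j => X i j ω) μ := by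
  have hmeas (i : ι) : Measurable fun ω j => X i j ω := measurable_pi_lambda _ (hX i)
  have (i : ι) := Measure.isProbabilityMeasure_map (μ := μ) (hmeas i).aemeasurable
  have hprob' (i : ι) (j : κ i) := Measure.isProbabilityMeasure_map (μ := μ) (hX i j).aemeasurable
  have hblock (i : ι) :
      μ.map (fun ω j => X i j ω) = Measure.infinitePi fun j => μ.map (X i j) :=
    (h.precomp (g := Sigma.mk i) sigma_mk_injective).map_fun_eq_infinitePi_map (hX i)
  rw [iIndepFun_iff_map_fun_eq_infinitePi_map hmeas]
  simp_rw [hblock]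
  rw [← Measure.infinitePi_map_piCurry fun i j => μ.map (X i j),
    ← h.map_fun_eq_infinitePi_map fun p => hX p.1 p.2,
    Measure.map_map (by fun_prop) (by fun_prop)]
  rfl

end Blocks

/-- The probability of the choices of one user in one frame. -/
noncomputable def userWeight (ρ γ : ℝ) (y : UserFrame M V) : ℝ :=
  (∏ t, bern ρ (y.1 t)) * bern γ y.2.1 * (1 / (V : ℝ))

/-- The mean of a function of the choices in a frame. -/
noncomputable def frameMean (ρ γ : ℝ) (G : (Fin N → UserFrame M V) → ℝ) : ℝ :=
  ∑ z, (∏ m, userWeight ρ γ (z m)) * G z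

/-- The labels of the basic random variables which enter frame `k + 1`. -/
def sourceOf (N M k : ℕ) : Fin N × (Fin M ⊕ Bool) → Source N
  | (m, .inl t) => .arrival m (k * M + t)
  | (m, .inr true) => .coin m (k + 1)
  | (m, .inr false) => .mini m (k + 1)

lemma sourceOf_injective :
    Function.Injective fun p : (_ : ℕ) × Fin N × (Fin M ⊕ Bool) => sourceOf N M p.1 p.2 := by
  rintro ⟨k, m, t | _ | _⟩ ⟨k', m', t' | _ | _⟩ h <;>
    simp only [sourceOf, Source.arrival.injEq, Source.coin.injEq, Source.mini.injEq,
      reduceCtorEq, add_left_inj] at h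
  · obtain ⟨rfl, hslot⟩ := h
    obtain rfl : k = k' := by
      rw [← mul_add_div_of_lt (k := k) t.2, hslot, mul_add_div_of_lt t'.2]
    obtain rfl : t = t' := Fin.ext (Nat.add_left_cancel hslot)
    rfl
  · rw [h.1, h.2]
  · rw [h.1, h.2]

/-- The frame in which the basic random variables have the values `x`. -/
def frameOfValues {k : ℕ} (x : (i : Fin N × (Fin M ⊕ Bool)) → (sourceOf N M k i).Value V) :
    Fin N → UserFrame M V :=
  fun m => (fun t => x (m, .inl t), x (m, .inr true), x (m, .inr false))

/-- The values of the basic random variables in a frame with choices `z`. -/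
def sourceValue (z : Fin N → UserFrame M V) (k : ℕ) :
    (i : Fin N × (Fin M ⊕ Bool)) → (sourceOf N M k i).Value V
  | (m, .inl t) => (z m).1 t
  | (m, .inr true) => (z m).2.1
  | (m, .inr false) => (z m).2.2

instance (s : Source N) : DiscreteMeasurableSpace (s.Value V) := ⟨fun _ => trivial⟩

instance (s : Source N) : Finite (s.Value V) := by
  cases s <;> unfold Source.Value <;> infer_instance

section Law

variable {Ω : Type*} [MeasurableSpace Ω] {μ : Measure Ω} {ρ γ : ℝ} {P : Ω → Path N V}

lemma IsNetwork.measurable_frameOf (hP : IsNetwork μ ρ γ P) (k : ℕ) :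
    Measurable fun ω => frameOf M (P ω) k :=
  (Measurable.of_discrete (f := frameOfValues)).comp
    (measurable_pi_lambda _ fun i => hP.measurable (sourceOf N M k i))

variable [IsProbabilityMeasure μ]

lemma measureReal_eq_bern {B : Ω → Bool} (hB : Measurable B) {x : ℝ}
    (hx : μ.real {ω | B ω = true} = x) (b : Bool) : μ.real {ω | B ω = b} = bern x b := by
  cases b with
  | true => simpa [bern] using hx
  | false =>
    have hcompl := probReal_compl_eq_one_sub (μ := μ) (hB (measurableSet_singleton true))
    rw [← hx, bern, if_neg Bool.false_ne_true]
    convert hcompl using 2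
    · ext ω
      simp
    · rfl

lemma IsNetwork.iIndepFun_frameOf (hP : IsNetwork μ ρ γ P) :
    iIndepFun (fun k ω => frameOf M (P ω) k) μ :=
  (iIndepFun_curry (X := fun k i => family P (sourceOf N M k i)) (fun _ _ => hP.measurable _)
    (hP.indep.precomp sourceOf_injective)).comp (fun _ => frameOfValues) fun _ => .of_discrete

lemma IsNetwork.measureReal_frameOf (hP : IsNetwork μ ρ γ P) (k : ℕ)
    (z : Fin N → UserFrame M V) :
    μ.real {ω | frameOf M (P ω) k = z} = ∏ m, userWeight ρ γ (z m) := by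
  have hinj : Function.Injective (sourceOf N M k) :=
    sourceOf_injective.comp (sigma_mk_injective (i := k))
  have hevent : {ω | frameOf M (P ω) k = z} =
      ⋂ i ∈ univ, family P (sourceOf N M k i) ⁻¹' {sourceValue z k i} := by
    ext ω
    simp only [Set.mem_ofPred_eq, Set.mem_iInter, mem_univ, forall_const, Set.mem_preimage,
      Set.mem_singleton_iff, Prod.forall, Sum.forall, Bool.forall_bool, funext_iff, Prod.ext_iff]
    exact forall_congr' fun m => and_congr_right fun _ => and_comm
  rw [hevent, measureReal_def, (hP.indep.precomp hinj).measure_inter_preimage_eq_mul univ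
    fun _ _ => .of_discrete, ENNReal.toReal_prod, Fintype.prod_prod_type]
  refine prod_congr rfl fun m _ => ?_
  rw [Fintype.prod_sum_type, Fintype.prod_bool, userWeight, ← mul_assoc]
  refine congrArg₂ _ (congrArg₂ _ (prod_congr rfl fun t _ => ?_) ?_) ?_
  · exact measureReal_eq_bern (hP.measurable (.arrival m _)) (hP.arrival_law m _) ((z m).1 t)
  · exact measureReal_eq_bern (hP.measurable (.coin m _)) (hP.coin_law m _) (z m).2.1
  · exact hP.mini_law m (k + 1) (z m).2.2

lemma IsNetwork.identDistrib_frameOf (hP : IsNetwork μ ρ γ P) (k l : ℕ) :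
    IdentDistrib (fun ω => frameOf M (P ω) k) (fun ω => frameOf M (P ω) l) μ μ where
  aemeasurable_fst := (hP.measurable_frameOf k).aemeasurable
  aemeasurable_snd := (hP.measurable_frameOf l).aemeasurable
  map_eq := by
    have hprob (i : ℕ) := Measure.isProbabilityMeasure_map (μ := μ)
      (hP.measurable_frameOf (M := M) i).aemeasurable
    have := hprob k
    have := hprob l
    refine ext_iff_measureReal_singleton.2 fun z => ?_
    rw [map_measureReal_apply (hP.measurable_frameOf k) (measurableSet_singleton z),
      map_measureReal_apply (hP.measurable_frameOf l) (measurableSet_singleton z)]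
    exact (hP.measureReal_frameOf k z).trans (hP.measureReal_frameOf l z).symm

lemma IsNetwork.integral_frameOf (hP : IsNetwork μ ρ γ P) (k : ℕ)
    (G : (Fin N → UserFrame M V) → ℝ) :
    ∫ ω, G (frameOf M (P ω) k) ∂μ = frameMean ρ γ G := by
  have hmeas := hP.measurable_frameOf (M := M) k
  have := Measure.isProbabilityMeasure_map (μ := μ) hmeas.aemeasurable
  rw [← integral_map (φ := fun ω => frameOf M (P ω) k) hmeas.aemeasurable
    (Measurable.of_discrete (f := G)).aestronglyMeasurable, integral_fintype .of_finite]
  refine sum_congr rfl fun z _ => ?_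
  rw [map_measureReal_apply hmeas (measurableSet_singleton z), smul_eq_mul,
    ← hP.measureReal_frameOf k z]
  rfl

end Law

/-! ### Averages over a frame -/

lemma sum_ite_served (z : Fin N → UserFrame M V) (n : Fin N) (m : ℕ) :
    ∑ j ∈ range m, (if Served z n j then (1 : ℝ) else 0) =
      if ServedBefore z n m then 1 else 0 := by
  by_cases h : ServedBefore z n m
  · obtain ⟨i, hi, hserved⟩ := h
    rw [if_pos ⟨i, hi, hserved⟩, sum_eq_single_of_mem i (mem_range.2 hi) fun j _ hj =>
      if_neg fun hserved' => hj (hserved'.unique hserved), if_pos hserved]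
  · rw [if_neg h]
    exact sum_eq_zero fun j hj => if_neg fun hserved => h ⟨j, mem_range.1 hj, hserved⟩

lemma sum_prod_bern {ι : Type*} [Fintype ι] [DecidableEq ι] (x : ℝ) (g : ι → Bool → ℝ) :
    ∑ a : ι → Bool, ∏ t, (bern x (a t) * g t (a t)) =
      ∏ t, (x * g t true + (1 - x) * g t false) := by
  rw [← Fintype.prod_sum fun t b => bern x b * g t b]
  simp [bern]

/-- The mean of `F` over the arrivals of one user in one frame, on the event that there is an
arrival. -/
noncomputable def arrivalMean (ρ : ℝ) (F : (Fin M → Bool) → ℝ) : ℝ :=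
  ∑ a with ∃ t, a t = true, (∏ t, bern ρ (a t)) * F a

lemma sum_prod_bern_mul (ρ : ℝ) (F : (Fin M → Bool) → ℝ) :
    ∑ a, (∏ t, bern ρ (a t)) * F a = arrivalMean ρ F + (1 - ρ) ^ M * F fun _ => false := by
  have hempty : ({a | ¬ ∃ t, a t = true} : Finset (Fin M → Bool)) = {fun _ => false} := by
    ext a
    simp [funext_iff]
  rw [arrivalMean, ← sum_filter_add_sum_filter_not univ fun a : Fin M → Bool => ∃ t, a t = true,
    hempty, sum_singleton]
  simp [bern]

lemma arrivalMean_one (M : ℕ) (ρ : ℝ) :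
    arrivalMean ρ (fun _ : Fin M → Bool => 1) = pUpdate M ρ := by
  have hsplit := sum_prod_bern_mul ρ fun _ : Fin M → Bool => 1
  have htotal := sum_prod_bern ρ fun (_ : Fin M) _ => 1
  simp only [mul_one, add_sub_cancel, prod_const_one] at hsplit htotal
  rw [pUpdate]
  linarith

lemma sum_userWeight_fst (ρ γ : ℝ) (F : (Fin M → Bool) → ℝ) (v : Fin V) :
    ∑ y : UserFrame M V with y.flag = true ∧ y.2.2 = v, userWeight ρ γ y * F y.1 =
      γ * arrivalMean ρ F / V := by
  rw [sum_filter, Fintype.sum_prod_type, arrivalMean, sum_filter, mul_sum, sum_div]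
  refine sum_congr rfl fun a _ => ?_
  rw [Fintype.sum_prod_type, Fintype.sum_bool]
  by_cases ha : ∃ t, a t = true
  · simp only [UserFrame.flag, ha, userWeight, bern, decide_true, Bool.and_true, true_and,
      Bool.and_false, Bool.false_eq_true, false_and, if_true, if_false, sum_ite_eq', mem_univ,
      sum_const_zero, add_zero]
    ring
  · simp [UserFrame.flag, ha]

lemma sum_userWeight_mini (ρ γ : ℝ) (v : Fin V) :
    ∑ y : UserFrame M V with y.2.2 = v, userWeight ρ γ y = 1 / V := by
  have htotal := sum_prod_bern ρ fun (_ : Fin M) _ => 1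
  simp only [mul_one, add_sub_cancel, prod_const_one] at htotal
  suffices hprod : ∑ y : UserFrame M V with y.2.2 = v, userWeight ρ γ y =
      (∑ a : Fin M → Bool, ∏ t, bern ρ (a t)) * (1 / V) by
    rw [hprod, htotal, one_mul]
  rw [sum_filter, Fintype.sum_prod_type, sum_mul]
  refine sum_congr rfl fun a _ => ?_
  rw [Fintype.sum_prod_type, Fintype.sum_bool]
  simp only [userWeight, bern, sum_ite_eq', mem_univ, if_true, Bool.false_eq_true, if_false]
  ring

lemma sum_userWeight_flag_mini (ρ γ : ℝ) (b : Bool) (v : Fin V) :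
    ∑ y : UserFrame M V with y.flag = b ∧ y.2.2 = v, userWeight ρ γ y =
      bern (pUpdate M ρ * γ) b / V := by
  have hflag := sum_userWeight_fst ρ γ (fun _ : Fin M → Bool => 1) v
  simp only [mul_one, arrivalMean_one, mul_comm γ] at hflag
  cases b with
  | true => exact hflag
  | false =>
    have hsplit := sum_filter_add_sum_filter_not ({y | y.2.2 = v} : Finset (UserFrame M V))
      (fun y => y.flag = true) (userWeight ρ γ)
    simp only [filter_filter, Bool.not_eq_true, and_comm (a := _ = v), sum_userWeight_mini,
      hflag] at hsplit
    rw [bern, if_neg Bool.false_ne_true, sub_div]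
    linarith

lemma frameMean_flag [NeZero V] (ρ γ : ℝ) (n : Fin N) :
    frameMean (M := M) (V := V) ρ γ (fun z => if (z n).flag = true then 1 else 0) =
      pUpdate M ρ * γ := by
  have hV : (V : ℝ) ≠ 0 := NeZero.ne _
  have hsum (b : Bool) : ∑ y : UserFrame M V with y.flag = b, userWeight ρ γ y =
      bern (pUpdate M ρ * γ) b := by
    rw [← sum_fiberwise _ fun y : UserFrame M V => y.2.2]
    simp only [filter_filter, sum_userWeight_flag_mini, sum_const, card_univ, Fintype.card_fin,
      nsmul_eq_mul]
    field_simp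
  have htotal : ∑ y : UserFrame M V, userWeight ρ γ y = 1 := by
    rw [← sum_fiberwise _ UserFrame.flag]
    simp [hsum, bern]
  calc
    _ = ∑ z : Fin N → UserFrame M V, ∏ m, (userWeight ρ γ (z m) *
        if m = n then (if (z m).flag = true then 1 else 0) else 1) := by
      refine sum_congr rfl fun z _ => ?_
      rw [prod_mul_distrib, prod_ite_eq' univ n, if_pos (mem_univ n)]
    _ = ∏ m, ∑ y : UserFrame M V, (userWeight ρ γ y *
        if m = n then (if y.flag = true then 1 else 0) else 1) :=
      (Fintype.prod_sum fun m y => userWeight ρ γ y *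
        if m = n then (if y.flag = true then 1 else 0) else 1).symm
    _ = pUpdate M ρ * γ := by
      rw [Fintype.prod_eq_single n fun m hm => by simp [hm, htotal]]
      simp [← sum_filter, hsum, bern]

/-- Given that a user reserves, the slot in which it is served is independent of its arrivals. -/
lemma frameMean_served [NeZero V] (ρ γ : ℝ) (F : (Fin M → Bool) → ℝ) (n : Fin N) (j : ℕ) :
    frameMean (V := V) ρ γ (fun z => if Served z n j then F (z n).1 else 0) =
      γ * arrivalMean ρ F * phi N M V ρ γ (j + 2) := by
  have h := sum_prod_mul_singleRank (flag := UserFrame.flag (M := M) (V := V))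
    (mini := fun y => y.2.2) (w := userWeight ρ γ) (F := fun y => F y.1)
    (θ := pUpdate M ρ * γ) (c := γ * arrivalMean ρ F)
    (by simpa only [Fintype.card_fin] using sum_userWeight_flag_mini ρ γ)
    (by simpa only [Fintype.card_fin] using sum_userWeight_fst ρ γ F) n j
  rw [Fintype.card_fin, Fintype.card_fin] at h
  rw [phi_add_two_eq_sum_rankPMF]
  exact h

lemma frameMean_sum_served [NeZero V] (ρ γ : ℝ) (n : Fin N) (c : ℕ → ℝ)
    (F : (Fin M → Bool) → ℝ) :
    frameMean (V := V) ρ γ (fun z =>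
      (∑ j ∈ range (M - 1), if Served z n j then c j else 0) * F (z n).1) =
      γ * arrivalMean ρ F * ∑ j ∈ range (M - 1), c j * phi N M V ρ γ (j + 2) := by
  simp only [frameMean, sum_mul, mul_sum]
  rw [sum_comm]
  refine sum_congr rfl fun j _ => ?_
  rw [mul_left_comm, ← frameMean_served ρ γ F n j, frameMean, mul_sum]
  refine sum_congr rfl fun z _ => ?_
  split_ifs <;> ring

lemma frameMean_servedBefore [NeZero V] (ρ γ : ℝ) (n : Fin N) (F : (Fin M → Bool) → ℝ) :
    frameMean (V := V) ρ γ (fun z =>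
      (if ServedBefore z n (M - 1) then 1 else 0) * F (z n).1) =
      γ * arrivalMean ρ F * pS N M V ρ γ := by
  simpa only [sum_ite_served, one_mul, ← pS_eq_sum_range_phi] using
    frameMean_sum_served ρ γ n (fun _ => 1) F

lemma frameMean_servedBefore_one [NeZero V] (ρ γ : ℝ) (n : Fin N) :
    frameMean (M := M) (V := V) ρ γ (fun z => if ServedBefore z n (M - 1) then 1 else 0) =
      pUpdate M ρ * γ * pS N M V ρ γ := by
  simpa only [mul_one, arrivalMean_one, mul_comm γ] using frameMean_servedBefore ρ γ n fun _ => 1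

/-! ### Successful updates -/

lemma pUpdate_pos (hM : 0 < M) {ρ : ℝ} (hρ : 0 < ρ) (hρ1 : ρ ≤ 1) : 0 < pUpdate M ρ := by
  rw [pUpdate, sub_pos]
  exact pow_lt_one₀ (by linarith) (by linarith) hM.ne'

lemma bern_nonneg {x : ℝ} (hx : 0 ≤ x) (hx1 : x ≤ 1) (b : Bool) : 0 ≤ bern x b := by
  unfold bern
  split_ifs <;> linarith

lemma userWeight_nonneg {ρ γ : ℝ} (hρ : 0 ≤ ρ) (hρ1 : ρ ≤ 1) (hγ : 0 ≤ γ) (hγ1 : γ ≤ 1)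
    (y : UserFrame M V) : 0 ≤ userWeight ρ γ y :=
  mul_nonneg (mul_nonneg (prod_nonneg fun _ _ => bern_nonneg hρ hρ1 _) (bern_nonneg hγ hγ1 _))
    (by positivity)

lemma userWeight_const_pos [NeZero V] {ρ γ : ℝ} {a c : Bool} (ha : 0 < bern ρ a)
    (hc : 0 < bern γ c) (v : Fin V) :
    0 < userWeight ρ γ ((fun _ => a, c, v) : UserFrame M V) :=
  mul_pos (mul_pos (prod_pos fun _ _ => ha) hc) (one_div_pos.2 (Nat.cast_pos.2 (NeZero.pos V)))

lemma frameMean_pos {ρ γ : ℝ} (hρ : 0 ≤ ρ) (hρ1 : ρ ≤ 1) (hγ : 0 ≤ γ) (hγ1 : γ ≤ 1)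
    {G : (Fin N → UserFrame M V) → ℝ} (hG : ∀ z, 0 ≤ G z) {z : Fin N → UserFrame M V}
    (hz : ∀ m, 0 < userWeight ρ γ (z m)) (hGz : 0 < G z) : 0 < frameMean ρ γ G :=
  sum_pos' (fun z _ => mul_nonneg
    (prod_nonneg fun m _ => userWeight_nonneg hρ hρ1 hγ hγ1 (z m)) (hG z))
    ⟨z, mem_univ z, mul_pos (prod_pos fun m _ => hz m) hGz⟩

lemma served_zero_of_forall_ne [NeZero V] {z : Fin N → UserFrame M V} {n : Fin N}
    (hflag : (z n).flag = true) (hmini : (z n).2.2 = 0)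
    (hne : ∀ m ≠ n, (z m).flag = true → (z m).2.2 ≠ 0) : Served z n 0 := by
  refine ⟨mem_singles.2 ⟨by simpa [reservers] using hflag, fun m hm hmn => ?_⟩, ?_⟩
  · rw [hmini]
    exact hne m hmn (by simpa [reservers] using hm)
  · simp [singleRank, hmini]

lemma exists_userWeight_pos_not_reserving_zero [NeZero V] {ρ γ : ℝ} (hρ : 0 < ρ) (hρ1 : ρ ≤ 1)
    (hγ : 0 < γ) (hγ1 : γ ≤ 1) (hne : ¬ (V = 1 ∧ ρ = 1 ∧ γ = 1)) :
    ∃ y : UserFrame M V, 0 < userWeight ρ γ y ∧ (y.flag = true → y.2.2 ≠ 0) := by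
  rcases hρ1.lt_or_eq with hρ_lt | hρ_eq
  · exact ⟨(fun _ => false, true, 0), userWeight_const_pos (by simpa [bern]) (by simpa [bern]) 0,
      by simp [UserFrame.flag]⟩
  rcases hγ1.lt_or_eq with hγ_lt | hγ_eq
  · exact ⟨(fun _ => true, false, 0), userWeight_const_pos (by simpa [bern]) (by simpa [bern]) 0,
      by simp [UserFrame.flag]⟩
  have hV : V ≠ 1 := fun hV => hne ⟨hV, hρ_eq, hγ_eq⟩
  have : Nontrivial (Fin V) := Fin.nontrivial_iff_two_le.2 (by have := NeZero.pos V; omega)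
  obtain ⟨v, hv⟩ := exists_ne (0 : Fin V)
  exact ⟨(fun _ => true, true, v), userWeight_const_pos (by simpa [bern]) (by simpa [bern]) v,
    fun _ => hv⟩

lemma exists_userWeight_pos_served [NeZero V] {ρ γ : ℝ} (hρ : 0 < ρ) (hρ1 : ρ ≤ 1) (hγ : 0 < γ)
    (hγ1 : γ ≤ 1) (hM : 0 < M) (hne : ¬ (V = 1 ∧ 2 ≤ N ∧ ρ = 1 ∧ γ = 1)) (n : Fin N) :
    ∃ z : Fin N → UserFrame M V, (∀ m, 0 < userWeight ρ γ (z m)) ∧ Served z n 0 := by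
  have hweight : 0 < userWeight ρ γ ((fun _ => true, true, 0) : UserFrame M V) :=
    userWeight_const_pos (by simpa [bern]) (by simpa [bern]) 0
  have hflag : UserFrame.flag ((fun _ => true, true, 0) : UserFrame M V) = true := by
    simpa [UserFrame.flag] using ⟨(⟨0, hM⟩ : Fin M)⟩
  by_cases hN : 2 ≤ N
  · obtain ⟨y, hy, hy_ne⟩ := exists_userWeight_pos_not_reserving_zero (V := V) hρ hρ1 hγ hγ1
      fun h => hne ⟨h.1, hN, h.2⟩
    refine ⟨fun m => if m = n then (fun _ => true, true, 0) else y, fun m => ?_,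
      served_zero_of_forall_ne ?_ ?_ ?_⟩
    · dsimp only
      split_ifs
      exacts [hweight, hy]
    · simpa using hflag
    · simp
    · intro m hm
      simpa only [if_neg hm] using hy_ne
  · have : Subsingleton (Fin N) := Fin.subsingleton_iff_le_one.2 (by omega)
    exact ⟨fun _ => (fun _ => true, true, 0), fun _ => hweight,
      served_zero_of_forall_ne hflag rfl fun m hm => absurd (Subsingleton.elim m n) hm⟩

lemma pS_pos [NeZero V] (hM : 2 ≤ M) {ρ γ : ℝ} (hρ : 0 < ρ) (hρ1 : ρ ≤ 1) (hγ : 0 < γ)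
    (hγ1 : γ ≤ 1) (hne : ¬ (V = 1 ∧ 2 ≤ N ∧ ρ = 1 ∧ γ = 1)) (n : Fin N) :
    0 < pS N M V ρ γ := by
  have hM0 : 0 < M := by omega
  obtain ⟨z, hz, hserved⟩ := exists_userWeight_pos_served hρ hρ1 hγ hγ1 hM0 hne n
  have hmean : 0 < pUpdate M ρ * γ * pS N M V ρ γ := by
    rw [← frameMean_servedBefore_one ρ γ n]
    refine frameMean_pos hρ.le hρ1 hγ.le hγ1 (fun z => by split_ifs <;> simp) hz ?_
    rw [if_pos ⟨0, by omega, hserved⟩]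
    exact one_pos
  exact pos_of_mul_pos_right hmean (mul_pos (pUpdate_pos hM0 hρ hρ1) hγ).le

lemma measureReal_cond {Ω : Type*} [MeasurableSpace Ω] {μ : Measure Ω} {s : Set Ω}
    (hs : MeasurableSet s) (t : Set Ω) : (cond μ s).real t = (μ.real s)⁻¹ * μ.real (s ∩ t) := by
  rw [measureReal_def, cond_apply hs, ENNReal.toReal_mul, ENNReal.toReal_inv]
  rfl

namespace IsNetwork

variable {Ω : Type*} [MeasurableSpace Ω] {μ : Measure Ω} {ρ γ : ℝ} {P : Ω → Path N V}

lemma measurableSet_frameOf (hP : IsNetwork μ ρ γ P) (k : ℕ)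
    (p : (Fin N → UserFrame M V) → Prop) : MeasurableSet {ω | p (frameOf M (P ω) k)} :=
  hP.measurable_frameOf k (MeasurableSet.of_discrete (s := {z | p z}))

variable [IsProbabilityMeasure μ]

lemma measureReal_frameOf_prop (hP : IsNetwork μ ρ γ P) (k : ℕ)
    (p : (Fin N → UserFrame M V) → Prop) [DecidablePred p] :
    μ.real {ω | p (frameOf M (P ω) k)} = frameMean ρ γ fun z => if p z then 1 else 0 := by
  rw [← hP.integral_frameOf k, ← integral_indicator_one (hP.measurableSet_frameOf k p)]
  refine integral_congr_ae (.of_forall fun ω => ?_)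
  simp [Set.indicator_apply]

lemma cond_reserves_frameOf [NeZero V] (hP : IsNetwork μ ρ γ P) (hM : 0 < M) (k : ℕ) (n : Fin N)
    {p : (Fin N → UserFrame M V) → Prop} [DecidablePred p]
    (hp : ∀ z, p z → (z n).flag = true) :
    (cond μ {ω | Reserves M (P ω) n (k + 1)}).real {ω | p (frameOf M (P ω) k)} =
      (frameMean ρ γ fun z => if p z then 1 else 0) / (pUpdate M ρ * γ) := by
  have hinter : {ω | (frameOf M (P ω) k n).flag = true} ∩ {ω | p (frameOf M (P ω) k)} =
      {ω | p (frameOf M (P ω) k)} := Set.inter_eq_right.2 fun ω h => hp _ h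
  simp only [reserves_succ_iff hM]
  rw [measureReal_cond (hP.measurableSet_frameOf k fun z => (z n).flag = true),
    hP.measureReal_frameOf_prop k fun z => (z n).flag = true, frameMean_flag,
    hinter, hP.measureReal_frameOf_prop k p, inv_mul_eq_div]

lemma cond_received [NeZero V] (hP : IsNetwork μ ρ γ P) (hρ : 0 < ρ) (hρ1 : ρ ≤ 1) (hγ : 0 < γ)
    (k : ℕ) (n : Fin N) {j : ℕ} (hj : j + 1 < M) :
    (cond μ {ω | Reserves M (P ω) n (k + 1)}).real
      {ω | Received M (P ω) n ((k + 1) * M + (j + 1))} = phi N M V ρ γ (j + 2) := by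
  have hM : 0 < M := by omega
  have hpos : 0 < pUpdate M ρ * γ := mul_pos (pUpdate_pos hM hρ hρ1) hγ
  have hmean := frameMean_served (V := V) ρ γ (fun _ : Fin M → Bool => 1) n j
  simp only [received_iff_served _ n k hj]
  rw [hP.cond_reserves_frameOf hM k n (p := fun z => Served z n j) fun _ h => h.flag, hmean,
    arrivalMean_one, mul_comm γ, mul_div_cancel_left₀ _ hpos.ne']

lemma cond_receivedInFrame [NeZero V] (hP : IsNetwork μ ρ γ P) (hM : 0 < M) (hρ : 0 < ρ)
    (hρ1 : ρ ≤ 1) (hγ : 0 < γ) (k : ℕ) (n : Fin N) :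
    (cond μ {ω | Reserves M (P ω) n (k + 1)}).real
      {ω | ReceivedInFrame M (P ω) n (k + 1)} = pS N M V ρ γ := by
  have hpos : 0 < pUpdate M ρ * γ := mul_pos (pUpdate_pos hM hρ hρ1) hγ
  simp only [receivedInFrame_succ_iff]
  rw [hP.cond_reserves_frameOf hM k n (p := fun z => ServedBefore z n (M - 1))
    fun _ h => h.flag, frameMean_servedBefore_one, mul_div_cancel_left₀ _ hpos.ne']

end IsNetwork

/-! ### Averages along an i.i.d. sequence -/

section Averages

variable {Ω S : Type*} {mΩ : MeasurableSpace Ω} {μ : Measure Ω}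

lemma ae_tendsto_zero_of_summable_integral_sq {Y : ℕ → Ω → ℝ}
    (hint : ∀ n, Integrable (fun ω => Y n ω ^ 2) μ)
    (hsum : Summable fun n => ∫ ω, Y n ω ^ 2 ∂μ) :
    ∀ᵐ ω ∂μ, Tendsto (fun n => Y n ω) atTop (𝓝 0) := by
  have hmeas : ∀ n, AEMeasurable (fun ω => ENNReal.ofReal (Y n ω ^ 2)) μ := fun n =>
    (hint n).aestronglyMeasurable.aemeasurable.ennreal_ofReal
  have hlintegral : ∀ n, ∫⁻ ω, ENNReal.ofReal (Y n ω ^ 2) ∂μ =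
      ENNReal.ofReal (∫ ω, Y n ω ^ 2 ∂μ) := fun n =>
    (ofReal_integral_eq_lintegral_ofReal (hint n) (.of_forall fun ω => sq_nonneg _)).symm
  have htsum : ∫⁻ ω, ∑' n, ENNReal.ofReal (Y n ω ^ 2) ∂μ ≠ ⊤ := by
    simp_rw [lintegral_tsum hmeas, hlintegral]
    rw [← ENNReal.ofReal_tsum_of_nonneg (fun n => integral_nonneg fun ω => sq_nonneg _) hsum]
    exact ENNReal.ofReal_ne_top
  filter_upwards [ae_lt_top' (AEMeasurable.tsum hmeas) htsum] with ω hω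
  have hofReal := (ENNReal.tendsto_toReal ENNReal.zero_ne_top).comp
    (ENNReal.tendsto_atTop_zero_of_tsum_ne_top hω.ne)
  have hsq : Tendsto (fun n => Y n ω ^ 2) atTop (𝓝 0) := by
    simpa [Function.comp_def, ENNReal.toReal_ofReal (sq_nonneg _)] using hofReal
  have habs := hsq.sqrt
  simp only [Real.sqrt_sq_eq_abs, Real.sqrt_zero] at habs
  exact (tendsto_zero_iff_abs_tendsto_zero _).2 habs

lemma ae_tendsto_div_sq_of_integral_sq_le {Y : ℕ → Ω → ℝ}
    (hint : ∀ n, Integrable (fun ω => Y n ω ^ 2) μ) {C : ℝ}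
    (hC : ∀ n, 0 < n → ∫ ω, Y n ω ^ 2 ∂μ ≤ C * n) :
    ∀ᵐ ω ∂μ, Tendsto (fun n : ℕ => Y (n ^ 2) ω / ((n ^ 2 : ℕ) : ℝ)) atTop (𝓝 0) := by
  refine ae_tendsto_zero_of_summable_integral_sq (fun n => ?_)
    (Summable.of_nonneg_of_le (fun n => integral_nonneg fun ω => sq_nonneg _) (fun n => ?_)
      ((Real.summable_nat_pow_inv.2 one_lt_two).mul_left C))
  · simp_rw [div_pow]
    exact (hint _).div_const _
  · simp_rw [div_pow, integral_div]
    rcases n.eq_zero_or_pos with rfl | hn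
    · simp
    rw [div_le_iff₀ (by positivity)]
    refine (hC _ (pow_pos hn 2)).trans_eq ?_
    push_cast
    field_simp

lemma integral_sum_sq_of_orthogonal {ι : Type*} (s : Finset ι) {D : ι → Ω → ℝ}
    (hD : ∀ i, MemLp (D i) 2 μ) (horth : Pairwise fun i j => ∫ ω, D i ω * D j ω ∂μ = 0) :
    ∫ ω, (∑ i ∈ s, D i ω) ^ 2 ∂μ = ∑ i ∈ s, ∫ ω, D i ω ^ 2 ∂μ := by
  have hint : ∀ i j, Integrable (fun ω => D i ω * D j ω) μ := fun i j =>
    (hD i).integrable_mul (hD j)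
  simp_rw [sq, sum_mul_sum]
  rw [integral_finsetSum _ fun i _ => integrable_finsetSum _ fun j _ => hint i j]
  refine sum_congr rfl fun i hi => ?_
  rw [integral_finsetSum _ fun j _ => hint i j,
    sum_eq_single_of_mem i hi fun j _ hji => horth hji.symm]

variable [mS : MeasurableSpace S] {X : ℕ → Ω → S}

/-- The σ-algebra of the events determined by `X 0, …, X (k - 1)`. -/
abbrev past (X : ℕ → Ω → S) (k : ℕ) : MeasurableSpace Ω := ⨆ i ∈ Set.Iio k, mS.comap (X i)

lemma past_mono {k l : ℕ} (hkl : k ≤ l) : past X k ≤ past X l :=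
  biSup_mono fun _ hi => lt_of_lt_of_le hi hkl

lemma measurable_past {i k : ℕ} (hik : i < k) : Measurable[past X k] (X i) :=
  (comap_measurable (X i)).mono (le_biSup (fun i => mS.comap (X i)) hik) le_rfl

/-- A sequence of independent, identically distributed random variables. -/
structure IsIIDSequence (μ : Measure Ω) (X : ℕ → Ω → S) : Prop where
  measurable : ∀ k, Measurable (X k)
  indep : iIndepFun X μ
  identDistrib : ∀ k, IdentDistrib (X k) (X 0) μ μ

namespace IsIIDSequence

lemma past_le (hX : IsIIDSequence μ X) (k : ℕ) : past X k ≤ mΩ :=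
  iSup₂_le fun i _ => (hX.measurable i).comap_le

lemma indepFun_past (hX : IsIIDSequence μ X) {k : ℕ} {A : Ω → ℝ}
    (hA : Measurable[past X k] A) : IndepFun A (X k) μ := by
  have hindep := indep_iSup_of_disjoint (fun i => (hX.measurable i).comap_le) hX.indep.iIndep
    (Set.disjoint_singleton_right.2 (lt_irrefl k) : Disjoint (Set.Iio k) {k})
  rw [_root_.iSup_singleton] at hindep
  exact (IndepFun_iff_Indep _ _ _).2 (indep_of_indep_of_le_left hindep hA.comap_le)

lemma integral_comp (hX : IsIIDSequence μ X) (k : ℕ) {ξ : S → ℝ} (hξ : Measurable ξ) :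
    ∫ ω, ξ (X k ω) ∂μ = ∫ ω, ξ (X 0 ω) ∂μ :=
  ((hX.identDistrib k).comp hξ).integral_eq

lemma memLp_comp (hX : IsIIDSequence μ X) (k : ℕ) {ξ : S → ℝ} (hξ : Measurable ξ)
    (hξ2 : MemLp (fun ω => ξ (X 0 ω)) 2 μ) : MemLp (fun ω => ξ (X k ω)) 2 μ :=
  ((hX.identDistrib k).comp hξ).memLp_iff.2 hξ2

lemma integral_past_mul (hX : IsIIDSequence μ X) {k : ℕ} {A : Ω → ℝ}
    (hA : Measurable[past X k] A) {ξ : S → ℝ} (hξ : Measurable ξ) :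
    ∫ ω, A ω * ξ (X k ω) ∂μ = (∫ ω, A ω ∂μ) * ∫ ω, ξ (X 0 ω) ∂μ := by
  rw [← hX.integral_comp k hξ]
  exact ((hX.indepFun_past hA).comp measurable_id hξ).integral_fun_mul_eq_mul_integral
    (hA.mono (hX.past_le k) le_rfl).aestronglyMeasurable
    (hξ.comp (hX.measurable k)).aestronglyMeasurable

lemma memLp_past_mul (hX : IsIIDSequence μ X) {k : ℕ} {A : Ω → ℝ}
    (hA : Measurable[past X k] A) (hA2 : MemLp A 2 μ) {ξ : S → ℝ} (hξ : Measurable ξ)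
    (hξ2 : MemLp (fun ω => ξ (X 0 ω)) 2 μ) : MemLp (fun ω => A ω * ξ (X k ω)) 2 μ := by
  have hξk := hX.memLp_comp k hξ hξ2
  refine (memLp_two_iff_integrable_sq (hA2.1.mul hξk.1)).2 ?_
  have hindep := (hX.indepFun_past hA).comp (measurable_id.pow_const 2) (hξ.pow_const 2)
  simp only [Pi.mul_apply, mul_pow]
  exact hindep.integrable_mul hA2.integrable_sq hξk.integrable_sq

lemma pairwise_integral_past_mul_eq_zero (hX : IsIIDSequence μ X) {A : ℕ → Ω → ℝ}
    (hA : ∀ k, Measurable[past X k] (A k)) {ζ : S → ℝ} (hζ : Measurable ζ)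
    (hζ0 : ∫ ω, ζ (X 0 ω) ∂μ = 0) :
    Pairwise fun i j => ∫ ω, A i ω * ζ (X i ω) * (A j ω * ζ (X j ω)) ∂μ = 0 := by
  have horth_lt : ∀ i j, i < j → ∫ ω, A i ω * ζ (X i ω) * (A j ω * ζ (X j ω)) ∂μ = 0 := by
    intro i j hij
    have hpast : Measurable[past X j] fun ω => A i ω * ζ (X i ω) * A j ω :=
      (((hA i).mono (past_mono hij.le) le_rfl).mul (hζ.comp (measurable_past hij))).mul (hA j)
    simp only [← mul_assoc]
    rw [hX.integral_past_mul hpast hζ, hζ0, mul_zero]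
  intro i j hij
  rcases hij.lt_or_gt with h | h
  · exact horth_lt i j h
  · simp only [mul_comm (A i _ * ζ _)]
    exact horth_lt j i h

lemma ae_tendsto_average_past_mul_sq_of_integral_eq_zero (hX : IsIIDSequence μ X)
    {A : ℕ → Ω → ℝ} (hA : ∀ k, Measurable[past X k] (A k)) (hA2 : ∀ k, MemLp (A k) 2 μ) {C : ℝ}
    (hC : ∀ k, ∫ ω, A k ω ^ 2 ∂μ ≤ C) {ζ : S → ℝ} (hζ : Measurable ζ)
    (hζ2 : MemLp (fun ω => ζ (X 0 ω)) 2 μ) (hζ0 : ∫ ω, ζ (X 0 ω) ∂μ = 0) :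
    ∀ᵐ ω ∂μ, Tendsto (fun n : ℕ => (∑ k ∈ range (n ^ 2), A k ω * ζ (X k ω)) / ((n ^ 2 : ℕ) : ℝ))
      atTop (𝓝 0) := by
  have hD : ∀ k, MemLp (fun ω => A k ω * ζ (X k ω)) 2 μ := fun k =>
    hX.memLp_past_mul (hA k) (hA2 k) hζ hζ2
  have hsq : ∀ k, ∫ ω, (A k ω * ζ (X k ω)) ^ 2 ∂μ ≤ C * ∫ ω, ζ (X 0 ω) ^ 2 ∂μ := by
    intro k
    simp only [mul_pow]
    rw [hX.integral_past_mul ((hA k).pow_const 2) (hζ.pow_const 2)]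
    exact mul_le_mul_of_nonneg_right (hC k) (integral_nonneg fun ω => sq_nonneg _)
  refine ae_tendsto_div_sq_of_integral_sq_le (Y := fun n ω => ∑ k ∈ range n, A k ω * ζ (X k ω))
    (fun n => (memLp_finsetSum _ fun k _ => hD k).integrable_sq)
    (C := C * ∫ ω, ζ (X 0 ω) ^ 2 ∂μ) fun n _ => ?_
  rw [integral_sum_sq_of_orthogonal _ hD (hX.pairwise_integral_past_mul_eq_zero hA hζ hζ0)]
  refine (sum_le_sum fun k _ => hsq k).trans_eq ?_
  rw [sum_const, card_range, nsmul_eq_mul, mul_comm]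

lemma ae_tendsto_average_past_mul_centered_sq [IsProbabilityMeasure μ] (hX : IsIIDSequence μ X)
    {A : ℕ → Ω → ℝ} (hA : ∀ k, Measurable[past X k] (A k)) (hA2 : ∀ k, MemLp (A k) 2 μ) {C : ℝ}
    (hC : ∀ k, ∫ ω, A k ω ^ 2 ∂μ ≤ C) {ξ : S → ℝ} (hξ : Measurable ξ)
    (hξ2 : MemLp (fun ω => ξ (X 0 ω)) 2 μ) :
    ∀ᵐ ω ∂μ, Tendsto (fun n : ℕ => (∑ k ∈ range (n ^ 2),
      A k ω * (ξ (X k ω) - ∫ ω', ξ (X 0 ω') ∂μ)) / ((n ^ 2 : ℕ) : ℝ)) atTop (𝓝 0) := by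
  have hcentered : MemLp (fun ω => ξ (X 0 ω) - ∫ ω', ξ (X 0 ω') ∂μ) 2 μ :=
    hξ2.sub (memLp_const _)
  refine hX.ae_tendsto_average_past_mul_sq_of_integral_eq_zero (ζ := fun x => ξ x - _)
    hA hA2 hC (hξ.sub_const _) hcentered ?_
  rw [integral_sub (hξ2.integrable one_le_two) (integrable_const _), integral_const,
    probReal_univ, one_smul, sub_self]

lemma ae_tendsto_average (hX : IsIIDSequence μ X) {ξ : S → ℝ} (hξ : Measurable ξ)
    (hint : Integrable (fun ω => ξ (X 0 ω)) μ) :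
    ∀ᵐ ω ∂μ, Tendsto (fun n : ℕ => (∑ k ∈ range n, ξ (X k ω)) / (n : ℝ)) atTop
      (𝓝 (∫ ω, ξ (X 0 ω) ∂μ)) :=
  strong_law_ae_real (fun k ω => ξ (X k ω)) hint
    (fun _ _ hij => (hX.indep.indepFun hij).comp hξ hξ) fun k => (hX.identDistrib k).comp hξ

end IsIIDSequence

end Averages

/-! ### Ages with random resets -/

section Reset

variable {S : Type*}

/-- An age observed at integer times: in step `k` it is reset to `W (x k)` if `s (x k)` holds, and
increases by `c` otherwise. -/
noncomputable def resetAge (c : ℝ) (s : S → Prop) [DecidablePred s] (W : S → ℝ) (x : ℕ → S) :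
    ℕ → ℝ
  | 0 => c
  | k + 1 => if s (x k) then W (x k) else resetAge c s W x k + c

variable {c : ℝ} {s : S → Prop} [DecidablePred s] {W : S → ℝ}

lemma sum_resetAge_mul_ite (x : ℕ → S) (n : ℕ) :
    ∑ k ∈ range n, resetAge c s W x k * (if s (x k) then 1 else 0) =
      n * c + (∑ k ∈ range n, if s (x k) then W (x k) - c else 0) - (resetAge c s W x n - c) := by
  induction n with
  | zero => simp [resetAge]
  | succ n ih =>
    rw [sum_range_succ, sum_range_succ, ih, resetAge]
    push_cast
    split_ifs <;> ring

lemma tendsto_average_resetAge {x : ℕ → S} {u : ℕ → ℕ} (hu : Tendsto u atTop atTop) {m q : ℝ}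
    (hq : q ≠ 0) (hage : Tendsto (fun n => resetAge c s W x (u n) / (u n : ℝ)) atTop (𝓝 0))
    (hreset : Tendsto (fun n => (∑ k ∈ range (u n), if s (x k) then W (x k) - c else 0) / (u n : ℝ))
      atTop (𝓝 m))
    (hcentered : Tendsto (fun n => (∑ k ∈ range (u n),
      resetAge c s W x k * ((if s (x k) then 1 else 0) - q)) / (u n : ℝ)) atTop (𝓝 0)) :
    Tendsto (fun n => (∑ k ∈ range (u n), resetAge c s W x k) / (u n : ℝ)) atTop
      (𝓝 ((c + m) / q)) := by
  have hconst : Tendsto (fun n => c / (u n : ℝ)) atTop (𝓝 0) :=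
    (tendsto_const_div_atTop_nhds_zero_nat c).comp hu
  have hlim := ((((hreset.const_add c).sub hage).add hconst).sub hcentered).div_const q
  rw [sub_zero, add_zero, sub_zero] at hlim
  refine hlim.congr' ?_
  filter_upwards [hu.eventually_gt_atTop 0] with n hn
  have hn' : (u n : ℝ) ≠ 0 := Nat.cast_ne_zero.2 hn.ne'
  simp only [mul_sub, sum_sub_distrib, sum_resetAge_mul_ite, ← sum_mul]
  field_simp
  ring

variable {Ω : Type*} {mΩ : MeasurableSpace Ω} {μ : Measure Ω} [MeasurableSpace S]
  {X : ℕ → Ω → S}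

lemma measurable_resetAge (hs : MeasurableSet {y | s y}) (hW : Measurable W) (k : ℕ) :
    Measurable[past X k] fun ω => resetAge c s W (fun i => X i ω) k := by
  induction k with
  | zero => exact measurable_const
  | succ k ih =>
    have hXk : Measurable[past X (k + 1)] (X k) := measurable_past k.lt_succ_self
    exact Measurable.ite (hXk hs) (hW.comp hXk)
      ((ih.mono (past_mono k.le_succ) le_rfl).add_const c)

lemma exists_forall_le_of_succ_le_mul_add {x : ℕ → ℝ} {r b : ℝ} (hr : 0 ≤ r) (hr1 : r < 1)
    (hx : ∀ k, x (k + 1) ≤ r * x k + b) : ∃ C, ∀ k, x k ≤ C := by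
  have hr1' : 0 < 1 - r := by linarith
  refine ⟨max (x 0) (b / (1 - r)), fun k => ?_⟩
  induction k with
  | zero => exact le_max_left _ _
  | succ k ih =>
    have hb : b ≤ (1 - r) * max (x 0) (b / (1 - r)) := by
      rw [← div_le_iff₀' hr1']
      exact le_max_right _ _
    linarith [hx k, mul_le_mul_of_nonneg_left ih hr]

lemma add_sq_le_one_add_mul_sq_add {q : ℝ} (hq : 0 < q) (a c : ℝ) :
    (a + c) ^ 2 ≤ (1 + q) * a ^ 2 + (1 + 1 / q) * c ^ 2 := by
  have hsq : 0 ≤ (q * a - c) ^ 2 / q := by positivity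
  have hexpand : (q * a - c) ^ 2 / q = q * a ^ 2 - 2 * a * c + 1 / q * c ^ 2 := by
    field_simp
    ring
  linarith

namespace IsIIDSequence

variable [IsProbabilityMeasure μ]

lemma memLp_resetAge (hX : IsIIDSequence μ X) (hs : MeasurableSet {y | s y}) (hW : Measurable W)
    (hW2 : MemLp (fun ω => W (X 0 ω)) 2 μ) (k : ℕ) :
    MemLp (fun ω => resetAge c s W (fun i => X i ω) k) 2 μ := by
  induction k with
  | zero => exact memLp_const c
  | succ k ih =>
    refine (((hX.memLp_comp k hW hW2).norm.add (ih.add (memLp_const c)).norm).mono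
      ((measurable_resetAge hs hW (k + 1)).mono
        (hX.past_le _) le_rfl).aestronglyMeasurable (.of_forall fun ω => ?_))
    simp only [resetAge, Pi.add_apply]
    rw [Real.norm_of_nonneg (by positivity : (0 : ℝ) ≤ ‖W (X k ω)‖ + _)]
    split_ifs
    · exact le_add_of_nonneg_right (norm_nonneg _)
    · exact le_add_of_nonneg_left (norm_nonneg _)

lemma memLp_ite_one_zero (hX : IsIIDSequence μ X) (hs : MeasurableSet {y | s y}) :
    MemLp (fun ω => if s (X 0 ω) then (1 : ℝ) else 0) 2 μ :=
  .of_bound (Measurable.ite (hX.measurable 0 hs) measurable_const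
    measurable_const).aestronglyMeasurable 1 (.of_forall fun ω => by split_ifs <;> simp)

lemma integral_resetAge_succ_sq_le (hX : IsIIDSequence μ X) (hs : MeasurableSet {y | s y})
    (hW : Measurable W) (hW2 : MemLp (fun ω => W (X 0 ω)) 2 μ) (k : ℕ) :
    ∫ ω, resetAge c s W (fun i => X i ω) (k + 1) ^ 2 ∂μ ≤
      (∫ ω, (resetAge c s W (fun i => X i ω) k + c) ^ 2 ∂μ) *
        (∫ ω, (1 - if s (X 0 ω) then 1 else 0) ∂μ) + ∫ ω, W (X 0 ω) ^ 2 ∂μ := by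
  have hA : Measurable[past X k] fun ω => (resetAge c s W (fun i => X i ω) k + c) ^ 2 :=
    ((measurable_resetAge hs hW k).add_const c).pow_const 2
  have hA2 : Integrable (fun ω => (resetAge c s W (fun i => X i ω) k + c) ^ 2) μ :=
    ((hX.memLp_resetAge hs hW hW2 k).add (memLp_const c)).integrable_sq
  have hkeep : Measurable fun y => 1 - if s y then (1 : ℝ) else 0 :=
    (Measurable.ite hs measurable_const measurable_const).const_sub 1
  have hprod : Integrable (fun ω => (resetAge c s W (fun i => X i ω) k + c) ^ 2 *
      (1 - if s (X k ω) then 1 else 0)) μ :=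
    hA2.mul_bdd (c := 1) (hkeep.comp (hX.measurable k)).aestronglyMeasurable
      (.of_forall fun ω => by split_ifs <;> simp)
  have hWk : Integrable (fun ω => W (X k ω) ^ 2) μ := (hX.memLp_comp k hW hW2).integrable_sq
  rw [← hX.integral_past_mul hA hkeep, ← hX.integral_comp k (hW.pow_const 2),
    ← integral_add hprod hWk]
  refine integral_mono (hX.memLp_resetAge hs hW hW2 (k + 1)).integrable_sq (hprod.add hWk)
    fun ω => ?_
  simp only [resetAge]
  split_ifs
  · simp
  · simpa using sq_nonneg (W (X k ω))

lemma exists_integral_resetAge_sq_le (hX : IsIIDSequence μ X) (hs : MeasurableSet {y | s y})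
    (hW : Measurable W) (hW2 : MemLp (fun ω => W (X 0 ω)) 2 μ)
    (hq : 0 < ∫ ω, (if s (X 0 ω) then (1 : ℝ) else 0) ∂μ) :
    ∃ C, ∀ k, ∫ ω, resetAge c s W (fun i => X i ω) k ^ 2 ∂μ ≤ C := by
  set q := ∫ ω, (if s (X 0 ω) then (1 : ℝ) else 0) ∂μ
  have hreset := (hX.memLp_ite_one_zero hs).integrable one_le_two
  have hkeep : ∫ ω, (1 - if s (X 0 ω) then (1 : ℝ) else 0) ∂μ = 1 - q := by
    rw [integral_sub (integrable_const _) hreset, integral_const, probReal_univ, one_smul]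
  have hq1 : 0 ≤ 1 - q := by
    rw [← hkeep]
    exact integral_nonneg fun ω => by dsimp only [Pi.zero_apply]; split_ifs <;> simp
  refine exists_forall_le_of_succ_le_mul_add (r := 1 - q ^ 2)
    (b := (1 + 1 / q) * c ^ 2 * (1 - q) + ∫ ω, W (X 0 ω) ^ 2 ∂μ) (by nlinarith) (by nlinarith)
    fun k => (hX.integral_resetAge_succ_sq_le hs hW hW2 k).trans ?_
  have hA := hX.memLp_resetAge (c := c) hs hW hW2 k
  have hyoung : ∫ ω, (resetAge c s W (fun i => X i ω) k + c) ^ 2 ∂μ ≤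
      (1 + q) * (∫ ω, resetAge c s W (fun i => X i ω) k ^ 2 ∂μ) + (1 + 1 / q) * c ^ 2 := by
    have hsq := hA.integrable_sq.const_mul (1 + q)
    have hconst := integrable_const (μ := μ) ((1 + 1 / q) * c ^ 2)
    calc _ ≤ ∫ ω, ((1 + q) * resetAge c s W (fun i => X i ω) k ^ 2 + (1 + 1 / q) * c ^ 2) ∂μ :=
          integral_mono (hA.add (memLp_const c)).integrable_sq (hsq.add hconst)
            fun ω => add_sq_le_one_add_mul_sq_add hq _ c
      _ = _ := by
          rw [integral_add hsq hconst, integral_const_mul, integral_const, probReal_univ,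
            one_smul]
  rw [hkeep]
  linarith [mul_le_mul_of_nonneg_right hyoung hq1]

lemma ae_tendsto_average_resetAge_sq (hX : IsIIDSequence μ X) (hs : MeasurableSet {y | s y})
    (hW : Measurable W) (hW2 : MemLp (fun ω => W (X 0 ω)) 2 μ)
    (hq : 0 < ∫ ω, (if s (X 0 ω) then (1 : ℝ) else 0) ∂μ) :
    ∀ᵐ ω ∂μ, Tendsto (fun n : ℕ => (∑ k ∈ range (n ^ 2), resetAge c s W (fun i => X i ω) k) /
      ((n ^ 2 : ℕ) : ℝ)) atTop (𝓝 ((c + ∫ ω, (if s (X 0 ω) then W (X 0 ω) - c else 0) ∂μ) /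
        ∫ ω, (if s (X 0 ω) then (1 : ℝ) else 0) ∂μ)) := by
  have hA := fun k => measurable_resetAge (X := X) (c := c) hs hW k
  have hA2 := fun k => hX.memLp_resetAge (c := c) hs hW hW2 k
  obtain ⟨C, hC⟩ := hX.exists_integral_resetAge_sq_le (c := c) hs hW hW2 hq
  have hC0 : 0 ≤ C := (integral_nonneg fun ω => sq_nonneg _).trans (hC 0)
  have hind : Measurable fun y => if s y then (1 : ℝ) else 0 :=
    Measurable.ite hs measurable_const measurable_const
  have hvalue : Measurable fun y => if s y then W y - c else 0 :=
    Measurable.ite hs (hW.sub_const c) measurable_const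
  have hvalue_int : Integrable (fun ω => if s (X 0 ω) then W (X 0 ω) - c else 0) μ :=
    ((hW2.integrable one_le_two).sub (integrable_const c)).mono
      (hvalue.comp (hX.measurable 0)).aestronglyMeasurable
      (.of_forall fun ω => by split_ifs <;> simp)
  filter_upwards [
    ae_tendsto_div_sq_of_integral_sq_le (fun k => (hA2 k).integrable_sq) fun n hn =>
      (hC n).trans (le_mul_of_one_le_right hC0 (Nat.one_le_cast.2 hn)),
    hX.ae_tendsto_average hvalue hvalue_int,
    hX.ae_tendsto_average_past_mul_centered_sq hA hA2 hC hind
      (hX.memLp_ite_one_zero hs)] with ω hage hreset hcentered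
  have hsq : Tendsto (fun n : ℕ => n ^ 2) atTop atTop := tendsto_pow_atTop two_ne_zero
  exact tendsto_average_resetAge hsq hq.ne' hage (hreset.comp hsq) hcentered

lemma ae_tendsto_average_resetAge_mul_sq (hX : IsIIDSequence μ X) (hs : MeasurableSet {y | s y})
    (hW : Measurable W) (hW2 : MemLp (fun ω => W (X 0 ω)) 2 μ)
    (hq : 0 < ∫ ω, (if s (X 0 ω) then (1 : ℝ) else 0) ∂μ) {ξ : S → ℝ} (hξ : Measurable ξ)
    (hξ2 : MemLp (fun ω => ξ (X 0 ω)) 2 μ) :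
    ∀ᵐ ω ∂μ, Tendsto (fun n : ℕ => (∑ k ∈ range (n ^ 2),
      resetAge c s W (fun i => X i ω) k * ξ (X k ω)) / ((n ^ 2 : ℕ) : ℝ)) atTop
        (𝓝 ((c + ∫ ω, (if s (X 0 ω) then W (X 0 ω) - c else 0) ∂μ) /
          (∫ ω, (if s (X 0 ω) then (1 : ℝ) else 0) ∂μ) * ∫ ω, ξ (X 0 ω) ∂μ)) := by
  obtain ⟨C, hC⟩ := hX.exists_integral_resetAge_sq_le (c := c) hs hW hW2 hq
  filter_upwards [hX.ae_tendsto_average_resetAge_sq (c := c) hs hW hW2 hq,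
    hX.ae_tendsto_average_past_mul_centered_sq (measurable_resetAge hs hW)
      (hX.memLp_resetAge hs hW hW2) hC hξ hξ2] with ω haverage hcentered
  have hlim := hcentered.add (haverage.mul_const (∫ ω, ξ (X 0 ω) ∂μ))
  rw [zero_add] at hlim
  refine hlim.congr fun n => ?_
  simp only [mul_sub, sum_sub_distrib, ← sum_mul]
  ring

end IsIIDSequence

end Reset

/-! ### The age of an update at the end of its frame -/

lemma lastArrival_lt_iff {m : ℕ} (hm : 0 < m) (a : Fin M → Bool) :
    lastArrival a < m ↔ ∀ t : Fin M, m ≤ t → a t = false := by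
  rw [lastArrival, Finset.sup_lt_iff hm]
  simp only [mem_filter, mem_univ, true_and]
  exact forall_congr' fun t => by
    rw [← not_imp_not, not_lt, Bool.not_eq_true]

lemma sum_range_ite_lastArrival_lt (a : Fin M → Bool) :
    ∑ j ∈ range M, (if lastArrival a < M - j then (1 : ℝ) else 0) = M - lastArrival a := by
  have hle : lastArrival a ≤ M := Finset.sup_le fun t _ => t.2.le
  have hfilter : {j ∈ range M | lastArrival a < M - j} = range (M - lastArrival a) := by
    ext j
    simp only [mem_filter, mem_range]
    omega
  rw [sum_boole, hfilter, card_range, Nat.cast_sub hle]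

lemma sum_prod_bern_mul_lastArrival_lt (ρ : ℝ) {j : ℕ} (hj : j < M) :
    ∑ a : Fin M → Bool, (∏ t, bern ρ (a t)) * (if lastArrival a < M - j then 1 else 0) =
      (1 - ρ) ^ j := by
  have hcard : #{t : Fin M | M - j ≤ t} = j := by
    have hsplit := card_filter_add_card_filter_not (s := univ) fun t : Fin M => (t : ℕ) < M - j
    simp only [Fin.card_filter_val_lt, not_lt, card_univ, Fintype.card_fin] at hsplit
    omega
  calc
    _ = ∑ a : Fin M → Bool, ∏ t : Fin M,
        (bern ρ (a t) * if M - j ≤ t → a t = false then 1 else 0) := by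
      refine sum_congr rfl fun a _ => ?_
      simp only [prod_mul_distrib, prod_boole, mem_univ, true_imp_iff,
        lastArrival_lt_iff (Nat.sub_pos_of_lt hj)]
    _ = ∏ t : Fin M, if M - j ≤ t then 1 - ρ else 1 := by
      rw [sum_prod_bern ρ fun (t : Fin M) b => if M - j ≤ t → b = false then 1 else 0]
      exact prod_congr rfl fun t _ => by by_cases ht : M - j ≤ t <;> simp [ht]
    _ = (1 - ρ) ^ j := by
      rw [prod_ite, prod_const, prod_const_one, mul_one, hcard]

lemma arrivalMean_sub_lastArrival {ρ : ℝ} (hρ : ρ ≠ 0) :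
    arrivalMean ρ (fun a : Fin M → Bool => (M : ℝ) - lastArrival a) =
      pUpdate M ρ / ρ - M * (1 - ρ) ^ M := by
  have htotal : ∑ a : Fin M → Bool, (∏ t, bern ρ (a t)) * ((M : ℝ) - lastArrival a) =
      pUpdate M ρ / ρ := by
    simp_rw [← sum_range_ite_lastArrival_lt, mul_sum]
    rw [sum_comm, sum_congr rfl fun j hj => sum_prod_bern_mul_lastArrival_lt ρ (mem_range.1 hj),
      geom_sum_eq (by simpa using hρ), pUpdate, ← neg_div_neg_eq]
    ring
  have hnone : lastArrival (fun _ : Fin M => false) = 0 := by simp [lastArrival]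
  rw [sum_prod_bern_mul, hnone, Nat.cast_zero, sub_zero] at htotal
  linarith

/-! ### The age within a frame -/

/-- The age of the update of user `n` at the end of the frame in which it could be transmitted. -/
noncomputable def resetValue (n : Fin N) (z : Fin N → UserFrame M V) : ℝ :=
  2 * M - lastArrival (z n).1

/-- The time from the reception of an update of user `n` to the end of the frame (`0` if there is
none). The user served after `j` others is received at time `j + 2` of the frame. -/
noncomputable def restTime (n : Fin N) (z : Fin N → UserFrame M V) : ℝ :=
  ∑ j ∈ range (M - 1), if Served z n j then (M : ℝ) - (j + 2) else 0

/-- The age of user `n` at the beginning of the frame with choices `x k`, when `u_n(0) = 0`. -/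
noncomputable abbrev frameAge (n : Fin N) (x : ℕ → Fin N → UserFrame M V) : ℕ → ℝ :=
  resetAge M (fun z => ServedBefore z n (M - 1)) (resetValue n) x

lemma latestGen_of_le (P : Path N V) (n : Fin N) (u₀ : ℤ) {t : ℕ} (ht : t ≤ M) :
    latestGen M P n u₀ t = u₀ := by
  induction t with
  | zero => rfl
  | succ t ih => rw [latestGen, if_neg (not_received_of_lt P n ht), ih (by omega)]

lemma servedBefore_succ_iff {z : Fin N → UserFrame M V} {n : Fin N} {m : ℕ} :
    ServedBefore z n (m + 1) ↔ ServedBefore z n m ∨ Served z n m :=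
  Nat.exists_lt_succ_right

lemma latestGen_frame (P : Path N V) (n : Fin N) (u₀ : ℤ) (k : ℕ) {i : ℕ} (hi : i ≤ M) :
    latestGen M P n u₀ ((k + 1) * M + i) =
      if ServedBefore (frameOf M P k) n (i - 1) then
        ((k * M + lastArrival (frameOf M P k n).1 : ℕ) : ℤ)
      else latestGen M P n u₀ ((k + 1) * M) := by
  induction i with
  | zero => simp [ServedBefore]
  | succ i ih =>
    rw [← add_assoc, latestGen]
    cases i with
    | zero =>
      rw [add_zero, if_neg (not_received_frame_start P n (k + 1))]
      simp [ServedBefore]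
    | succ j =>
      rw [mul_add_div_of_lt hi, ih (Nat.le_of_succ_le hi)]
      simp only [received_iff_served P n k hi, Nat.add_sub_cancel, servedBefore_succ_iff]
      by_cases hserved : Served (frameOf M P k) n j
      · rw [if_pos hserved, if_pos (.inr hserved),
          genTime_succ (by omega) P n k hserved.exists_arrival]
      · simp only [hserved, if_false, or_false]

lemma aoi_frame_start (P : Path N V) (n : Fin N) (k : ℕ) :
    (aoi M P n 0 ((k + 1) * M) : ℝ) = frameAge n (frameOf M P) k := by
  induction k with
  | zero => simp [aoi, latestGen_of_le, resetAge]
  | succ k ih =>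
    rw [frameAge] at ih
    rw [aoi, add_mul (k + 1), one_mul, latestGen_frame P n 0 k le_rfl, frameAge, resetAge, ← ih,
      aoi, resetValue]
    split_ifs <;> push_cast <;> ring

lemma restTime_eq_sum_ite (n : Fin N) (z : Fin N → UserFrame M V) :
    restTime n z = ∑ i ∈ range M, if ServedBefore z n (i - 1) then (1 : ℝ) else 0 := by
  have hterm : ∀ j ∈ range (M - 1), (if Served z n j then (M : ℝ) - (j + 2) else 0) =
      ∑ i ∈ range M, if j < i - 1 then (if Served z n j then (1 : ℝ) else 0) else 0 := by
    intro j hj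
    have hcard : {i ∈ range M | j < i - 1} = Ico (j + 2) M := by
      ext i
      simp only [mem_filter, mem_range, mem_Ico]
      omega
    rw [← sum_filter, sum_const, hcard, Nat.card_Ico, nsmul_eq_mul, mul_ite, mul_one, mul_zero,
      Nat.cast_sub (by rw [mem_range] at hj; omega)]
    norm_num
  rw [restTime, sum_congr rfl hterm, sum_comm]
  refine sum_congr rfl fun i hi => ?_
  have hrange : {j ∈ range (M - 1) | j < i - 1} = range (i - 1) := by
    ext j
    simp only [mem_filter, mem_range] at hi ⊢
    omega
  rw [← sum_filter, hrange, sum_ite_served]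

lemma sum_range_cast (m : ℕ) : ∑ i ∈ range m, (i : ℝ) = m * (m - 1) / 2 := by
  rw [← Nat.cast_sum, sum_range_id, ← Nat.choose_two_right, Nat.cast_choose_two]

lemma sum_aoi_frame (P : Path N V) (n : Fin N) (k : ℕ) :
    ∑ i ∈ range M, (aoi M P n 0 ((k + 1) * M + i) : ℝ) =
      M * frameAge n (frameOf M P) k + M * (M - 1) / 2 -
        (frameAge n (frameOf M P) k * restTime n (frameOf M P k) -
          restTime n (frameOf M P k) * (resetValue n (frameOf M P k) - M)) := by
  have hterm : ∀ i ∈ range M, (aoi M P n 0 ((k + 1) * M + i) : ℝ) =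
      frameAge n (frameOf M P) k + i -
        (if ServedBefore (frameOf M P k) n (i - 1) then (1 : ℝ) else 0) *
          (frameAge n (frameOf M P) k - (resetValue n (frameOf M P k) - M)) := by
    intro i hi
    rw [← aoi_frame_start P n k, aoi, latestGen_frame P n 0 k (mem_range.1 hi).le, aoi,
      resetValue]
    split_ifs <;> push_cast <;> ring
  rw [sum_congr rfl hterm, sum_sub_distrib, sum_add_distrib, ← sum_mul, ← restTime_eq_sum_ite,
    sum_range_cast, sum_const, card_range, nsmul_eq_mul]
  ring

lemma sum_aoi_frames (P : Path N V) (n : Fin N) (K : ℕ) :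
    ∑ t ∈ range (M * (K + 1)), (aoi M P n 0 t : ℝ) =
      M * (M - 1) / 2 + ∑ k ∈ range K, ∑ i ∈ range M, (aoi M P n 0 ((k + 1) * M + i) : ℝ) := by
  induction K with
  | zero =>
    rw [zero_add, mul_one, sum_range_zero, add_zero, ← sum_range_cast]
    refine sum_congr rfl fun t ht => ?_
    rw [aoi, latestGen_of_le P n 0 (mem_range.1 ht).le, sub_zero, Int.cast_natCast]
  | succ K ih =>
    rw [mul_add_one, sum_range_add, ih, sum_range_succ, add_assoc, mul_comm M (K + 1)]

lemma genTime_le (P : Path N V) (n : Fin N) (k : ℕ) : genTime M P n k ≤ k * M :=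
  Finset.sup_le fun _ hx => (mem_range.1 (mem_filter.1 hx).1).le

lemma latestGen_le (P : Path N V) (n : Fin N) (t : ℕ) : latestGen M P n 0 t ≤ t := by
  induction t with
  | zero => simp [latestGen]
  | succ t ih =>
    rw [latestGen]
    split_ifs
    · have hgen := (genTime_le P n (t / M)).trans (Nat.div_mul_le_self t M)
      omega
    · omega

lemma aoi_nonneg (P : Path N V) (n : Fin N) (t : ℕ) : 0 ≤ aoi M P n 0 t :=
  sub_nonneg.2 (latestGen_le P n t)

lemma latestGen_eq_of_received {P : Path N V} {n : Fin N} {t₀ : ℕ} (h : Received M P n t₀)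
    (u v : ℤ) {t : ℕ} (ht : t₀ < t) : latestGen M P n u t = latestGen M P n v t := by
  induction t, ht using Nat.le_induction with
  | base => simp only [latestGen, h, if_true]
  | succ t _ ih => rw [latestGen, latestGen, ih]

/-! ### The average age -/

lemma tendsto_average_of_tendsto_sq {m : ℕ} (hm : 0 < m) {f : ℕ → ℝ} (hf : ∀ t, 0 ≤ f t) {l : ℝ}
    (h : Tendsto (fun K : ℕ => (∑ t ∈ range (m * (K ^ 2 + 1)), f t) /
      ((m * (K ^ 2 + 1) : ℕ) : ℝ)) atTop (𝓝 l)) :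
    Tendsto (fun T : ℕ => (∑ t ∈ range T, f t) / (T : ℝ)) atTop (𝓝 l) := by
  refine tendsto_div_of_monotone_of_exists_subseq_tendsto_div _ l
    (fun a b hab => sum_le_sum_of_subset_of_nonneg (range_mono hab) fun t _ _ => hf t)
    fun a ha => ⟨fun K => m * (K ^ 2 + 1), ?_, ?_, h⟩
  · have ha' : 0 < a - 1 := by linarith
    filter_upwards [eventually_ge_atTop 1, eventually_ge_atTop ⌈3 / (a - 1)⌉₊] with K hK1 hK
    have hK1' : (1 : ℝ) ≤ K := by exact_mod_cast hK1
    have hKa : 3 ≤ K * (a - 1) := (div_le_iff₀ ha').1 (Nat.ceil_le.1 hK)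
    have hratio : ((K : ℝ) + 1) ^ 2 + 1 ≤ a * ((K : ℝ) ^ 2 + 1) := by nlinarith
    push_cast
    rw [mul_left_comm]
    exact mul_le_mul_of_nonneg_left hratio m.cast_nonneg
  · refine tendsto_atTop_mono (fun K => ?_) tendsto_id
    calc K ≤ K ^ 2 := Nat.le_self_pow two_ne_zero K
      _ ≤ m * (K ^ 2 + 1) := (Nat.le_succ _).trans (Nat.le_mul_of_pos_left _ hm)

lemma tendsto_average_aoi_of_received {P : Path N V} {n : Fin N} {t₀ : ℕ}
    (h : Received M P n t₀) (u v : ℤ) {l : ℝ}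
    (hl : Tendsto (fun T : ℕ => (∑ t ∈ range T, (aoi M P n u t : ℝ)) / (T : ℝ)) atTop (𝓝 l)) :
    Tendsto (fun T : ℕ => (∑ t ∈ range T, (aoi M P n v t : ℝ)) / (T : ℝ)) atTop (𝓝 l) := by
  have hdiff := tendsto_const_div_atTop_nhds_zero_nat
    (∑ t ∈ range (t₀ + 1), ((aoi M P n v t : ℝ) - aoi M P n u t))
  have hlim := hl.add hdiff
  rw [add_zero] at hlim
  refine hlim.congr' ?_
  filter_upwards [eventually_ge_atTop (t₀ + 1)] with T hT
  have hsum : ∑ t ∈ range (t₀ + 1), ((aoi M P n v t : ℝ) - aoi M P n u t) =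
      ∑ t ∈ range T, ((aoi M P n v t : ℝ) - aoi M P n u t) := by
    refine sum_subset (range_mono hT) fun t _ ht => ?_
    rw [aoi, aoi, latestGen_eq_of_received h v u (by simpa using ht), sub_self]
  rw [hsum, sum_sub_distrib]
  ring

lemma tendsto_average_aoi_frames (hM : 0 < M) (P : Path N V) (n : Fin N) {u : ℕ → ℕ}
    (hu : Tendsto u atTop atTop) {a b g : ℝ}
    (hage : Tendsto (fun K => (∑ k ∈ range (u K), frameAge n (frameOf M P) k) / (u K : ℝ))
      atTop (𝓝 a))
    (hage_rest : Tendsto (fun K => (∑ k ∈ range (u K),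
      frameAge n (frameOf M P) k * restTime n (frameOf M P k)) / (u K : ℝ)) atTop (𝓝 b))
    (hreset_rest : Tendsto (fun K => (∑ k ∈ range (u K), restTime n (frameOf M P k) *
      (resetValue n (frameOf M P k) - M)) / (u K : ℝ)) atTop (𝓝 g)) :
    Tendsto (fun K => (∑ t ∈ range (M * (u K + 1)), (aoi M P n 0 t : ℝ)) /
      ((M * (u K + 1) : ℕ) : ℝ)) atTop (𝓝 (a + (M - 1) / 2 - (b - g) / M)) := by
  have hM' : (M : ℝ) ≠ 0 := Nat.cast_ne_zero.2 hM.ne'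
  have hratio : Tendsto (fun K => (u K : ℝ) / ((u K : ℝ) + 1)) atTop (𝓝 1) :=
    (tendsto_natCast_div_add_atTop (1 : ℝ)).comp hu
  have hconst : Tendsto (fun K => ((M : ℝ) - 1) / 2 / (u K : ℝ)) atTop (𝓝 0) :=
    (tendsto_const_div_atTop_nhds_zero_nat _).comp hu
  have hlim := (((hage.add_const (((M : ℝ) - 1) / 2)).add hconst).sub
    ((hage_rest.sub hreset_rest).div_const (M : ℝ))).mul hratio
  rw [add_zero, mul_one] at hlim
  refine hlim.congr' ?_
  filter_upwards [hu.eventually_gt_atTop 0] with K hK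
  have hK' : (u K : ℝ) ≠ 0 := Nat.cast_ne_zero.2 hK.ne'
  have hK1 : (u K : ℝ) + 1 ≠ 0 := by positivity
  rw [sum_aoi_frames, sum_congr rfl fun k _ => sum_aoi_frame P n k, sum_sub_distrib,
    sum_add_distrib, sum_sub_distrib, ← mul_sum, sum_const, card_range, nsmul_eq_mul,
    Nat.cast_mul, Nat.cast_add_one]
  field_simp
  ring

lemma frameMean_restTime_mul [NeZero V] (ρ γ : ℝ) (n : Fin N) (F : (Fin M → Bool) → ℝ) :
    frameMean (V := V) ρ γ (fun z => restTime n z * F (z n).1) =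
      γ * arrivalMean ρ F * (M * pS N M V ρ γ - ∑ α ∈ Icc 2 M, phi N M V ρ γ α * α) := by
  have hslots := sum_Icc_two_eq_sum_range M fun α => phi N M V ρ γ α * α
  simp only [restTime]
  rw [frameMean_sum_served ρ γ n (fun j => (M : ℝ) - (j + 2)) F, hslots, pS_eq_sum_range_phi]
  congr 1
  rw [mul_sum, ← sum_sub_distrib]
  refine sum_congr rfl fun j _ => ?_
  push_cast
  ring

lemma frameMean_restTime [NeZero V] (ρ γ : ℝ) (n : Fin N) :
    frameMean (M := M) (V := V) ρ γ (restTime n) =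
      γ * pUpdate M ρ * (M * pS N M V ρ γ - ∑ α ∈ Icc 2 M, phi N M V ρ γ α * α) := by
  simpa only [mul_one, arrivalMean_one] using
    frameMean_restTime_mul (M := M) (V := V) ρ γ n fun _ => 1

lemma resetValue_sub (n : Fin N) (z : Fin N → UserFrame M V) :
    resetValue n z - M = M - lastArrival (z n).1 := by
  rw [resetValue]
  ring

lemma frameMean_restTime_mul_resetValue [NeZero V] {ρ : ℝ} (hρ : ρ ≠ 0) (γ : ℝ) (n : Fin N) :
    frameMean (M := M) (V := V) ρ γ (fun z => restTime n z * (resetValue n z - M)) =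
      γ * (pUpdate M ρ / ρ - M * (1 - ρ) ^ M) *
        (M * pS N M V ρ γ - ∑ α ∈ Icc 2 M, phi N M V ρ γ α * α) := by
  simpa only [resetValue_sub, arrivalMean_sub_lastArrival hρ] using
    frameMean_restTime_mul (V := V) ρ γ n fun a : Fin M → Bool => (M : ℝ) - lastArrival a

lemma frameMean_ite_resetValue [NeZero V] {ρ : ℝ} (hρ : ρ ≠ 0) (γ : ℝ) (n : Fin N) :
    frameMean (M := M) (V := V) ρ γ (fun z =>
      if ServedBefore z n (M - 1) then resetValue n z - M else 0) =
      γ * (pUpdate M ρ / ρ - M * (1 - ρ) ^ M) * pS N M V ρ γ := by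
  simpa only [resetValue_sub, arrivalMean_sub_lastArrival hρ, ite_mul, one_mul, zero_mul] using
    frameMean_servedBefore (V := V) ρ γ n fun a : Fin M → Bool => (M : ℝ) - lastArrival a

/-- The average age at the beginnings of the frames: per frame, the age grows by `M` and a reset
(whose probability is the denominator) replaces it by a new value with a mean excess over `M`. -/
noncomputable def meanFrameAge (N M V : ℕ) (ρ γ : ℝ) : ℝ :=
  (M + γ * (pUpdate M ρ / ρ - M * (1 - ρ) ^ M) * pS N M V ρ γ) /
    (pUpdate M ρ * γ * pS N M V ρ γ)

lemma meanFrameAge_add_sub_eq {ρ γ : ℝ} (hM : 0 < M) (hρ : 0 < ρ) (hρ1 : ρ ≤ 1) (hγ : γ ≠ 0)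
    (hpS : pS N M V ρ γ ≠ 0) (τ : ℝ) :
    meanFrameAge N M V ρ γ + (M - 1) / 2 -
        (meanFrameAge N M V ρ γ * (γ * pUpdate M ρ * (M * pS N M V ρ γ - τ)) -
          γ * (pUpdate M ρ / ρ - M * (1 - ρ) ^ M) * (M * pS N M V ρ γ - τ)) / M =
      M / (γ * pS N M V ρ γ * (1 - (1 - ρ) ^ M)) - M * (1 - ρ) ^ M / (1 - (1 - ρ) ^ M) + 1 / ρ -
        (M + 1) / 2 + τ / pS N M V ρ γ := by
  have hp := (pUpdate_pos hM hρ hρ1).ne'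
  have hM' : (M : ℝ) ≠ 0 := Nat.cast_ne_zero.2 hM.ne'
  have hpow : (1 - ρ) ^ M = 1 - pUpdate M ρ := (sub_sub_cancel 1 _).symm
  rw [meanFrameAge, hpow, sub_sub_cancel]
  field_simp
  ring

section Law

variable {Ω : Type*} [MeasurableSpace Ω] {μ : Measure Ω} [IsProbabilityMeasure μ] {ρ γ : ℝ}
  {P : Ω → Path N V}

lemma IsNetwork.isIIDSequence_frameOf (hP : IsNetwork μ ρ γ P) :
    IsIIDSequence μ fun k ω => frameOf M (P ω) k where
  measurable := hP.measurable_frameOf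
  indep := hP.iIndepFun_frameOf
  identDistrib k := hP.identDistrib_frameOf k 0

lemma IsNetwork.memLp_frameOf (hP : IsNetwork μ ρ γ P) (k : ℕ)
    (G : (Fin N → UserFrame M V) → ℝ) : MemLp (fun ω => G (frameOf M (P ω) k)) 2 μ :=
  .of_bound (Measurable.of_discrete (f := G) |>.comp (hP.measurable_frameOf k)).aestronglyMeasurable
    (∑ z, ‖G z‖) (.of_forall fun _ => single_le_sum (f := fun z => ‖G z‖)
      (fun _ _ => norm_nonneg _) (mem_univ _))

lemma IsNetwork.ae_tendsto_average_frameOf (hP : IsNetwork μ ρ γ P)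
    (G : (Fin N → UserFrame M V) → ℝ) :
    ∀ᵐ ω ∂μ, Tendsto (fun K : ℕ => (∑ k ∈ range K, G (frameOf M (P ω) k)) / (K : ℝ)) atTop
      (𝓝 (frameMean ρ γ G)) := by
  rw [← hP.integral_frameOf 0]
  exact hP.isIIDSequence_frameOf.ae_tendsto_average .of_discrete
    ((hP.memLp_frameOf 0 G).integrable one_le_two)

variable [NeZero V]

lemma IsNetwork.ae_exists_received (hP : IsNetwork μ ρ γ P) (hM : 0 < M) (hρ : 0 < ρ)
    (hρ1 : ρ ≤ 1) (hγ : 0 < γ) (hpS : 0 < pS N M V ρ γ) (n : Fin N) :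
    ∀ᵐ ω ∂μ, ∃ t, Received M (P ω) n t := by
  filter_upwards [hP.ae_tendsto_average_frameOf (M := M)
    fun z => if ServedBefore z n (M - 1) then 1 else 0] with ω hω
  by_contra hnone
  have hzero (k : ℕ) : ¬ ServedBefore (frameOf M (P ω) k) n (M - 1) := fun hserved => by
    obtain ⟨t, -, hrec⟩ := (receivedInFrame_succ_iff (P ω) n k).2 hserved
    exact hnone ⟨t, hrec⟩
  simp only [hzero, if_false, sum_const_zero, zero_div, frameMean_servedBefore_one] at hω
  have hp := pUpdate_pos hM hρ hρ1
  have hq : 0 < pUpdate M ρ * γ * pS N M V ρ γ := by positivity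
  exact hq.ne (tendsto_nhds_unique tendsto_const_nhds hω)

lemma IsNetwork.ae_tendsto_average_frameAge_sq (hP : IsNetwork μ ρ γ P) (hM : 0 < M) (hρ : 0 < ρ)
    (hρ1 : ρ ≤ 1) (hγ : 0 < γ) (hpS : 0 < pS N M V ρ γ) (n : Fin N) :
    ∀ᵐ ω ∂μ,
      Tendsto (fun K : ℕ => (∑ k ∈ range (K ^ 2), frameAge n (frameOf M (P ω)) k) /
        ((K ^ 2 : ℕ) : ℝ)) atTop (𝓝 (meanFrameAge N M V ρ γ)) ∧
      Tendsto (fun K : ℕ => (∑ k ∈ range (K ^ 2), frameAge n (frameOf M (P ω)) k *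
        restTime n (frameOf M (P ω) k)) / ((K ^ 2 : ℕ) : ℝ)) atTop
        (𝓝 (meanFrameAge N M V ρ γ * frameMean (M := M) (V := V) ρ γ (restTime n))) := by
  have hp := pUpdate_pos hM hρ hρ1
  have hreset : ∫ ω, (if ServedBefore (frameOf M (P ω) 0) n (M - 1) then (1 : ℝ) else 0) ∂μ =
      pUpdate M ρ * γ * pS N M V ρ γ := by
    rw [hP.integral_frameOf 0 fun z => if ServedBefore z n (M - 1) then 1 else 0,
      frameMean_servedBefore_one]
  have hexcess : ∫ ω, (if ServedBefore (frameOf M (P ω) 0) n (M - 1) then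
      resetValue n (frameOf M (P ω) 0) - M else 0) ∂μ =
      γ * (pUpdate M ρ / ρ - M * (1 - ρ) ^ M) * pS N M V ρ γ := by
    rw [hP.integral_frameOf 0 fun z => if ServedBefore z n (M - 1) then resetValue n z - M else 0,
      frameMean_ite_resetValue hρ.ne']
  have hX := hP.isIIDSequence_frameOf (M := M)
  have hq : 0 < ∫ ω, (if ServedBefore (frameOf M (P ω) 0) n (M - 1) then (1 : ℝ) else 0) ∂μ := by
    rw [hreset]
    positivity
  filter_upwards [
    hX.ae_tendsto_average_resetAge_sq (c := M) (s := fun z => ServedBefore z n (M - 1))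
      .of_discrete .of_discrete (hP.memLp_frameOf 0 (resetValue n)) hq,
    hX.ae_tendsto_average_resetAge_mul_sq (c := M) (s := fun z => ServedBefore z n (M - 1))
      .of_discrete .of_discrete (hP.memLp_frameOf 0 (resetValue n)) hq .of_discrete
      (hP.memLp_frameOf 0 (restTime n))]
    with ω hage hage_rest
  rw [hexcess, hreset] at hage hage_rest
  rw [hP.integral_frameOf 0 (restTime n)] at hage_rest
  exact ⟨hage, hage_rest⟩

theorem IsNetwork.ae_tendsto_average_aoi (hP : IsNetwork μ ρ γ P) (hM : 0 < M) (hρ : 0 < ρ)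
    (hρ1 : ρ ≤ 1) (hγ : 0 < γ) (hpS : 0 < pS N M V ρ γ) (n : Fin N) (u₀ : Ω → ℤ) :
    ∀ᵐ ω ∂μ, Tendsto (fun T : ℕ => (∑ t ∈ range T, (aoi M (P ω) n (u₀ ω) t : ℝ)) / (T : ℝ)) atTop
      (𝓝 (M / (γ * pS N M V ρ γ * (1 - (1 - ρ) ^ M)) - M * (1 - ρ) ^ M / (1 - (1 - ρ) ^ M) +
        1 / ρ - (M + 1) / 2 + (∑ α ∈ Icc 2 M, phi N M V ρ γ α * α) / pS N M V ρ γ)) := by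
  have hsq : Tendsto (fun K : ℕ => K ^ 2) atTop atTop := tendsto_pow_atTop two_ne_zero
  filter_upwards [hP.ae_exists_received hM hρ hρ1 hγ hpS n,
    hP.ae_tendsto_average_frameAge_sq hM hρ hρ1 hγ hpS n,
    hP.ae_tendsto_average_frameOf fun z => restTime n z * (resetValue n z - M)]
    with ω ⟨t₀, hreceived⟩ ⟨hage, hage_rest⟩ hreset_rest
  have hframes := tendsto_average_aoi_frames hM (P ω) n hsq hage hage_rest (hreset_rest.comp hsq)
  rw [frameMean_restTime, frameMean_restTime_mul_resetValue hρ.ne',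
    meanFrameAge_add_sub_eq hM hρ hρ1 hγ.ne' hpS.ne'] at hframes
  exact tendsto_average_aoi_of_received hreceived 0 (u₀ ω) (tendsto_average_of_tendsto_sq hM
    (fun t => Int.cast_nonneg (aoi_nonneg (P ω) n t)) hframes)

end Law

end FSARD

theorem mainTheorem1 {Ω : Type*} [MeasurableSpace Ω] (μ : MeasureTheory.Measure Ω)
    [MeasureTheory.IsProbabilityMeasure μ]
    (N M V : ℕ) (hM : 2 ≤ M) (hV : 1 ≤ V) (ρ γ : ℝ)
    (hρ : 0 < ρ) (hρ1 : ρ ≤ 1) (hγ : 0 < γ) (hγ1 : γ ≤ 1)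
    -- in the one excluded case every reservation of every frame `k ≥ 1` collides
    (hne : ¬ (V = 1 ∧ 2 ≤ N ∧ ρ = 1 ∧ γ = 1))
    (P : Ω → FSARD.Path N V) (hP : FSARD.IsNetwork μ ρ γ P)
    (n : Fin N) (u₀ : Ω → ℤ) :
    -- `p_s` is the probability of a successful update, given that the user reserves
    0 < FSARD.pS N M V ρ γ ∧
    (∀ k : ℕ, 1 ≤ k →
      (ProbabilityTheory.cond μ {ω | FSARD.Reserves M (P ω) n k}).real
        {ω | FSARD.ReceivedInFrame M (P ω) n k} = FSARD.pS N M V ρ γ) ∧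
    -- `φ_α` is the probability of an update in the `α`-th slot of the frame, given the same
    (∀ k : ℕ, 1 ≤ k → ∀ α ∈ Finset.Icc 2 M,
      (ProbabilityTheory.cond μ {ω | FSARD.Reserves M (P ω) n k}).real
        {ω | FSARD.Received M (P ω) n (k * M + (α - 1))} = FSARD.phi N M V ρ γ α) ∧
    -- the average age of information
    (∀ᵐ ω ∂μ, Filter.Tendsto
      (fun T : ℕ => (∑ t ∈ Finset.range T, (FSARD.aoi M (P ω) n (u₀ ω) t : ℝ)) / (T : ℝ))
      Filter.atTop
      (nhds ((M : ℝ) / (γ * FSARD.pS N M V ρ γ * (1 - (1 - ρ) ^ M))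
        - (M : ℝ) * (1 - ρ) ^ M / (1 - (1 - ρ) ^ M) + 1 / ρ - ((M : ℝ) + 1) / 2
        + (∑ α ∈ Finset.Icc 2 M, FSARD.phi N M V ρ γ α * (α : ℝ))
            / FSARD.pS N M V ρ γ))) := by
  have hM0 : 0 < M := by omega
  have : NeZero V := ⟨by omega⟩
  have hpS := FSARD.pS_pos hM hρ hρ1 hγ hγ1 hne n
  refine ⟨hpS, fun k hk => ?_, fun k hk α hα => ?_,
    hP.ae_tendsto_average_aoi hM0 hρ hρ1 hγ hpS n u₀⟩
  · obtain ⟨k, rfl⟩ := Nat.exists_eq_add_of_le' hk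
    exact hP.cond_receivedInFrame hM0 hρ hρ1 hγ k n
  · obtain ⟨hα2, hαM⟩ := Finset.mem_Icc.1 hα
    obtain ⟨k, rfl⟩ := Nat.exists_eq_add_of_le' hk
    obtain ⟨j, rfl⟩ := Nat.exists_eq_add_of_le' hα2
    exact hP.cond_received hρ hρ1 hγ k n (by omega)
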